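/- **Formulas and sequents.** Formulas are built from propositional variables $p_0,p_1,\dots$ and $\bot$ by means of $\to$, $\Box$ and $\Box^+$. A sequent $\Sigma;\Gamma\Rightarrow\Delta$ consists of an arbitrary set $\Sigma$ of formulas and finite multisets $\Gamma,\Delta$ of formulas. For a multiset $\Gamma=A_1,\dots,A_n$ put $\Box\Gamma=\Box A_1,\dots,\Box A_n$ and $\Box^+\Gamma=\Box^+A_1,\dots,\Box^+A_n$. **Calculus.** The initial sequents of $\mathsf S+\mathsf{cut}$ are $\Sigma;\Gamma,p\Rightarrow p,\Delta$ ($p$ a variable) and $\Sigma;\Gamma,\bot\Rightarrow\Delta$; its rules are (premises listed from left to right) - $(\to_L)$: from $\Sigma;\Gamma,B\Rightarrow\Delta$ and $\Sigma;\Gamma\Rightarrow A,\Delta$ infer $\Sigma;\Gamma,A\to B\Rightarrow\Delta$; - $(\to_R)$: from $\Sigma;\Gamma,A\Rightarrow B,\Delta$ infer $\Sigma;\Gamma\Rightarrow A\to B,\Delta$; - $(\Box)$: from $\Sigma;\Sigma_0,\Lambda,\Pi,\Box^+\Pi\Rightarrow A$ infer $\Sigma;\Phi,\Box\Lambda,\Box^+\Pi\Rightarrow\Box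 A,\Psi$; - $(\Box^+)$: from $\Sigma;\Sigma_0,\Lambda,\Pi,\Box^+\Pi\Rightarrow A$ and $\Sigma;\Sigma_0,\Lambda,\Pi,\Box^+\Pi\Rightarrow\Box^+A$ infer $\Sigma;\Phi,\Box\Lambda,\Box^+\Pi\Rightarrow\Box^+A,\Psi$; - $(\mathsf{cut})$: from $\Sigma;\Gamma\Rightarrow A,\Delta$ and $\Sigma;\Gamma,A\Rightarrow\Delta$ infer $\Sigma;\Gamma\Rightarrow\Delta$, where $\Sigma_0$ is a finite subset of $\Sigma$. The rules $(\Box)$ and $(\Box^+)$ are called modal, with principal formulas $\Box A$ and $\Box^+A$. An application of a modal rule is *slim* if $\Lambda$ and $\Pi$ can be taken without repetitions. **$\infty$-proofs.** An $\infty$-proof is a possibly infinite tree marked by sequents, constructed according to the rules of $\mathsf S+\mathsf{cut}$, whose leaves are initial sequents and in which every infinite branch has a tail such that: (a) all applications of $(\Box^+)$ in the tail have the same principal formula; (b) the tail passes through the right premise of $(\Box^+)$ infinitely many times; (c) it does not pass through the left premise of $(\Box^+)$; (d) it contains no application of $(\Box)$. Let $\mathsf P$ be the set of all $\infty$-proofs.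 **Annotations and fragments.** An annotation $s$ is a formula or the sign $\circ$. For $\pi\in\mathsf P$ with root $\Sigma;\Gamma\Rightarrow\Delta$, let $\mathit{Ann}(\pi)=\{\circ\}\cup\{A\mid\Box^+A\in\Delta\}$. For $s\in\mathit{Ann}(\pi)$, the annotated tree $\pi^s$ is obtained by annotating the root with $s$ and proceeding upwards: the premise of $(\Box)$ and the left premise of $(\Box^+)$ get $\circ$, the right premise of $(\Box^+)$ with principal formula $\Box^+A$ gets $A$, and premises of all other rules inherit the annotation of the conclusion. An application of $(\Box^+)$ in $\pi^s$ has *level* $n>0$ if the path from the root to its right premise goes through no premise of $(\Box)$ and no left premise of $(\Box^+)$, all annotations on this path are equal to $s$, and it passes through exactly $n$ applications of $(\Box^+)$ (the given one included). For $n>0$, the *$n$-fragment* of $\pi^s$ is obtained by removing all right premises of applications of $(\Box^+)$ of level $n$ together with their descendants (the rule applied at each remaining node is kept as part of the fragment). For $n>0$: $\pi\sim^s_n\tau$ means that $s\in\mathit{Ann}(\pi)\cap\mathit{Ann}(\tau)$ and the $n$-fragments of $\pi^s$ and $\tau^s$ coincide; $\pi\in\mathsf{CF}_n(s)$ means that $s\in\mathit{Ann}(\pi)$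 and there is no application of $(\mathsf{cut})$ in the $n$-fragment of $\pi^s$; $\pi\in\mathsf{SM}_n(s)$ means that $s\in\mathit{Ann}(\pi)$ and every application of a modal rule whose conclusion belongs to the $n$-fragment of $\pi^s$ is slim. For $n=0$ each of these notions requires only that $s$ belongs to $\mathit{Ann}$ of the $\infty$-proofs involved. **Operations.** A binary operation on $\mathsf P$ is a function $\mathsf a\colon\mathsf P\times\mathsf P\to\mathsf P$ such that $\mathit{Ann}(\pi)\cap\mathit{Ann}(\tau)\subset\mathit{Ann}(\mathsf a(\pi,\tau))$ for all $\pi,\tau$. It is - *$A$-removing* if, whenever $\pi$ is an $\infty$-proof of $\Sigma;\Gamma\Rightarrow A,\Delta$ and $\tau$ is an $\infty$-proof of $\Sigma;\Gamma,A\Rightarrow\Delta$, $\mathsf a(\pi,\tau)$ is an $\infty$-proof of $\Sigma;\Gamma\Rightarrow\Delta$; - *non-expansive* if $\pi\sim^s_i\pi'$ and $\tau\sim^s_i\tau'$ imply $\mathsf a(\pi,\tau)\sim^s_i\mathsf a(\pi',\tau')$, for all $s$ and $i\in\mathbb N$; - *non-pollutive* if $\pi,\tau\in\mathsf{CF}_i(s)$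 implies $\mathsf a(\pi,\tau)\in\mathsf{CF}_i(s)$, for all $s$ and $i\in\mathbb N$; - *non-fattening* if $\pi,\tau\in\mathsf{SM}_i(s)$ implies $\mathsf a(\pi,\tau)\in\mathsf{SM}_i(s)$, for all $s$ and $i\in\mathbb N$. **Proposition.** For any formula $A$, there exists a non-expansive, non-pollutive and non-fattening $A$-removing operation $\mathsf{re}_A$ on $\mathsf P$. -/

import Mathlib

/-- Formulas of the bimodal logic of transitive closure. -/
inductive Formula : Type
  | var : ℕ → Formula
  | bot : Formula
  | imp : Formula → Formula → Formula
  | box : Formula → Formula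
  | boxPlus : Formula → Formula

/-- A sequent `ctx ; ant ⇒ suc`: `ctx` is an arbitrary set of formulas, `ant` and `suc` are
finite multisets of formulas. -/
@[ext]
structure Sequent : Type where
  ctx : Set Formula
  ant : Multiset Formula
  suc : Multiset Formula

/-- Names of the rules, with the principal formula (the cut formula in the case of `cut`).
`impL A B` and `impR A B` have the principal formula `A → B`, `box A` has the principal formula
`□ A`, and `boxPlus A` has the principal formula `□⁺ A`. Given a conclusion and its list of
premises, the name of the rule is uniquely determined. -/
inductive Rule : Type
  | ax : Rule
  | impL : Formula → Formula → Rule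
  | impR : Formula → Formula → Rule
  | box : Formula → Rule
  | boxPlus : Formula → Rule
  | cut : Formula → Rule

/-- The rules `□` and `□⁺` are the modal rules. -/
def Rule.IsModal : Rule → Prop
  | .box _ => True
  | .boxPlus _ => True
  | _ => False

/-- `ModalStep S Γ Θ L P`: for some multiset `Φ` and some finite subset `S₀` of `S`, the
antecedent `Γ` of the conclusion of a modal rule is `Φ, □ L, □⁺ P`, and the antecedent `Θ` of its
premises is `S₀, L, P, □⁺ P`. -/
def ModalStep (S : Set Formula) (Γ Θ L P : Multiset Formula) : Prop :=
  ∃ (Φ : Multiset Formula) (S₀ : Finset Formula), (↑S₀ : Set Formula) ⊆ S ∧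
    Γ = Φ + L.map Formula.box + P.map Formula.boxPlus ∧
    Θ = S₀.val + L + P + P.map Formula.boxPlus

/-- `Inference c r ps`: from the list of premises `ps` (from left to right) one obtains the
conclusion `c` by one application of the rule `r` of the calculus with cut. -/
inductive Inference : Sequent → Rule → List Sequent → Prop
  | axVar (S : Set Formula) (Γ Δ : Multiset Formula) (p : ℕ) :
      Inference ⟨S, Formula.var p ::ₘ Γ, Formula.var p ::ₘ Δ⟩ Rule.ax []
  | axBot (S : Set Formula) (Γ Δ : Multiset Formula) :
      Inference ⟨S, Formula.bot ::ₘ Γ, Δ⟩ Rule.ax []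
  | impL (S : Set Formula) (Γ Δ : Multiset Formula) (A B : Formula) :
      Inference ⟨S, Formula.imp A B ::ₘ Γ, Δ⟩ (Rule.impL A B)
        [⟨S, B ::ₘ Γ, Δ⟩, ⟨S, Γ, A ::ₘ Δ⟩]
  | impR (S : Set Formula) (Γ Δ : Multiset Formula) (A B : Formula) :
      Inference ⟨S, Γ, Formula.imp A B ::ₘ Δ⟩ (Rule.impR A B) [⟨S, A ::ₘ Γ, B ::ₘ Δ⟩]
  | box (S : Set Formula) (Γ Θ L P Ψ : Multiset Formula) (A : Formula)
      (h : ModalStep S Γ Θ L P) :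
      Inference ⟨S, Γ, Formula.box A ::ₘ Ψ⟩ (Rule.box A) [⟨S, Θ, {A}⟩]
  | boxPlus (S : Set Formula) (Γ Θ L P Ψ : Multiset Formula) (A : Formula)
      (h : ModalStep S Γ Θ L P) :
      Inference ⟨S, Γ, Formula.boxPlus A ::ₘ Ψ⟩ (Rule.boxPlus A)
        [⟨S, Θ, {A}⟩, ⟨S, Θ, {Formula.boxPlus A}⟩]
  | cut (S : Set Formula) (Γ Δ : Multiset Formula) (A : Formula) :
      Inference ⟨S, Γ, Δ⟩ (Rule.cut A) [⟨S, Γ, A ::ₘ Δ⟩, ⟨S, A ::ₘ Γ, Δ⟩]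

/-- A (possibly infinite) binary tree whose nodes are marked by a sequent and the name of the rule
applied there. A node is the list of steps that lead to it from the root: `false` goes to the left
(or the only) premise and `true` to the right premise. The value `none` means: no such node. -/
abbrev SeqTree : Type := List Bool → Option (Sequent × Rule)

/-- The rule applied at a node. -/
def SeqTree.ruleAt (t : SeqTree) (w : List Bool) : Option Rule := (t w).map Prod.snd

/-- The sequent at a node. -/
def SeqTree.seqAt (t : SeqTree) (w : List Bool) : Option Sequent := (t w).map Prod.fst

/-- The first `n` steps of an infinite path. -/
def pathPrefix (f : ℕ → Bool) (n : ℕ) : List Bool := (List.range n).map f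

/-- Conditions (a)-(d) on the tail, from step `N` on, of the infinite branch `f`, with the
common principal formula `□⁺ A`. -/
def GoodTail (t : SeqTree) (f : ℕ → Bool) (N : ℕ) (A : Formula) : Prop :=
  (∀ n ≥ N, ∀ B, t.ruleAt (pathPrefix f n) = some (Rule.boxPlus B) → B = A) ∧
  (∀ m, ∃ n ≥ m, ∃ B, t.ruleAt (pathPrefix f n) = some (Rule.boxPlus B) ∧ f n = true) ∧
  (∀ n ≥ N, ∀ B, t.ruleAt (pathPrefix f n) = some (Rule.boxPlus B) → f n ≠ false) ∧
  (∀ n ≥ N, ∀ B, t.ruleAt (pathPrefix f n) ≠ some (Rule.box B))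

/-- An `∞`-proof of the calculus with cut. -/
@[ext]
structure InfProof : Type where
  tree : SeqTree
  root_mem : (tree []).isSome
  closed : ∀ w b, tree w = none → tree (w ++ [b]) = none
  step : ∀ w c r, tree w = some (c, r) →
    ∃ ps : List Sequent, Inference c r ps ∧ ∀ b : Bool, tree.seqAt (w ++ [b]) = ps[b.toNat]?
  branch : ∀ f : ℕ → Bool, (∀ n, (tree (pathPrefix f n)).isSome) → ∃ N A, GoodTail tree f N A

/-- The sequent at the root of an `∞`-proof. -/
def InfProof.root (π : InfProof) : Sequent := ((π.tree []).get π.root_mem).1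

/-- Annotations: `none` is the auxiliary sign `∘`. -/
abbrev Annot : Type := Option Formula

/-- The set of all possible annotations of a sequent. -/
def Sequent.Ann (c : Sequent) : Set Annot :=
  {s | ∀ A, s = some A → Formula.boxPlus A ∈ c.suc}

/-- The set of all possible annotations of the root of an `∞`-proof. -/
def InfProof.Ann (π : InfProof) : Set Annot := π.root.Ann

/-- The annotation of a premise (right if `b` is `true`, left or only if `b` is `false`) in the
annotated version of a rule, where `s` is the annotation of the conclusion. -/
def Rule.next (s : Annot) (b : Bool) : Rule → Annot
  | .box _ => none
  | .boxPlus A => if b then some A else none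
  | _ => s

/-- The annotation of a node after the root has been annotated with `s` and all rules have been
replaced, upwards from the root, with their annotated versions. -/
def annAt : SeqTree → Annot → List Bool → Annot
  | _, s, [] => s
  | t, s, b :: w =>
    annAt (fun v => t (b :: v)) (((t.ruleAt []).map (Rule.next s b)).getD s) w

/-- The node `w` of the tree annotated from `s` is `≈`-equivalent to the root: the path between
them does not go through the premise of a rule `□` or the left premise of a rule `□⁺`, and all
sequents on it have the same annotation. -/
def EquivRoot (t : SeqTree) (s : Annot) (w : List Bool) : Prop :=
  ∀ v b, (v ++ [b]) <+: w →
    (∀ A, t.ruleAt v ≠ some (Rule.box A)) ∧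
    (∀ A, t.ruleAt v = some (Rule.boxPlus A) → b ≠ false) ∧
    annAt t s (v ++ [b]) = s

/-- The number of applications of the rule `□⁺` that the path from the root to `w` passes
through. -/
noncomputable def boxPlusCount (t : SeqTree) (w : List Bool) : ℕ :=
  Set.ncard {v : List Bool | v <+: w ∧ v ≠ w ∧ ∃ A, t.ruleAt v = some (Rule.boxPlus A)}

/-- `w` is the right premise of an application of the rule `□⁺` of level `n`. -/
def IsLevelPremise (t : SeqTree) (s : Annot) (n : ℕ) (w : List Bool) : Prop :=
  (∃ v A, w = v ++ [true] ∧ t.ruleAt v = some (Rule.boxPlus A)) ∧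
    EquivRoot t s w ∧ boxPlusCount t w = n

/-- `w` is a node of the `n`-fragment: it is a node of the tree, and it is neither a right premise
of a rule `□⁺` of level `n` nor a descendant of such a premise. -/
def InFragment (t : SeqTree) (s : Annot) (n : ℕ) (w : List Bool) : Prop :=
  (t w).isSome ∧ ∀ v, v <+: w → ¬ IsLevelPremise t s n v

open Classical in
/-- The `n`-fragment of the annotated tree, with annotations, sequents and rule names. -/
noncomputable def fragment (t : SeqTree) (s : Annot) (n : ℕ) :
    List Bool → Option (Annot × Sequent × Rule) :=
  fun w => if InFragment t s n w then (t w).map (fun l => (annAt t s w, l)) else none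

/-- The relation `π ∼ⁿₛ τ` on the set of `∞`-proofs that can be annotated with `s`. -/
def Sim (s : Annot) (n : ℕ) (π τ : InfProof) : Prop :=
  s ∈ π.Ann ∧ s ∈ τ.Ann ∧ (0 < n → fragment π.tree s n = fragment τ.tree s n)

/-- The set `CFₙ(s)`. -/
def CF (n : ℕ) (s : Annot) : Set InfProof :=
  {π | s ∈ π.Ann ∧ (0 < n → ∀ w, InFragment π.tree s n w →
    ∀ A, π.tree.ruleAt w ≠ some (Rule.cut A))}

/-- If a modal rule is applied at the node `w`, then this application is slim, i.e. the multisets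
of formulas that are boxed in its conclusion can be taken without repetitions. -/
def SlimAt (t : SeqTree) (w : List Bool) : Prop :=
  ∀ c r p, t w = some (c, r) → r.IsModal → t.seqAt (w ++ [false]) = some p →
    ∃ L P : Multiset Formula, L.Nodup ∧ P.Nodup ∧ ModalStep c.ctx c.ant p.ant L P

/-- The set `SMₙ(s)`. -/
def SM (n : ℕ) (s : Annot) : Set InfProof :=
  {π | s ∈ π.Ann ∧ (0 < n → ∀ w, InFragment π.tree s n w → SlimAt π.tree w)}

/-- Binary operations on `∞`-proofs are the functions that preserve annotations. -/
def IsBinaryOperation (a : InfProof → InfProof → InfProof) : Prop :=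
  ∀ π τ, π.Ann ∩ τ.Ann ⊆ (a π τ).Ann

/-- `(π, τ)` is a cut pair with the cut formula `A` and the cut result `c`. -/
def IsCutPair (A : Formula) (c : Sequent) (π τ : InfProof) : Prop :=
  π.root = ⟨c.ctx, c.ant, A ::ₘ c.suc⟩ ∧ τ.root = ⟨c.ctx, A ::ₘ c.ant, c.suc⟩

/-- `A`-removing operations. -/
def IsRemoving (A : Formula) (a : InfProof → InfProof → InfProof) : Prop :=
  IsBinaryOperation a ∧ ∀ c π τ, IsCutPair A c π τ → (a π τ).root = c

/-- Non-expansive operations. -/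
def NonExpansive (a : InfProof → InfProof → InfProof) : Prop :=
  ∀ (s : Annot) (i : ℕ) (π τ π' τ' : InfProof),
    Sim s i π π' → Sim s i τ τ' → Sim s i (a π τ) (a π' τ')

/-- Non-pollutive operations. -/
def NonPollutive (a : InfProof → InfProof → InfProof) : Prop :=
  ∀ (s : Annot) (i : ℕ) (π τ : InfProof), π ∈ CF i s → τ ∈ CF i s → a π τ ∈ CF i s

/-- Non-fattening operations. -/
def NonFattening (a : InfProof → InfProof → InfProof) : Prop :=
  ∀ (s : Annot) (i : ℕ) (π τ : InfProof), π ∈ SM i s → τ ∈ SM i s → a π τ ∈ SM i s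

/-! Cuts are removed by induction on the cut formula, working lazily from the root. An ∞-proof
begins with a finite tree of non-modal inferences, its main tree, whose modal leaves carry the
remaining proofs. A cut is driven through the two main trees by inversion and permutation. Where two
modal inferences meet on the cut formula, they are merged into one and cuts are left pending in its
premises: a cut on B for □B; for □⁺B a cut on □⁺B against the right premise of the left-hand
□⁺-inference, followed by a cut on B. A `CutTerm` records pending cuts, `CutTerm.head` computes its
main tree, and `MainTree.render` unfolds it into an infinite tree.

The cut on □⁺B does not get simpler by merging, so the branch condition must be used. That condition
is a nested fixed point: a branch changes its annotation finitely often (least fixed point), and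
then passes for ever through right premises of □⁺ with one principal formula (greatest fixed point).
`Good` is this nested fixed point. Its inner layer is given by the approximations `Frag`, and the
i-th approximation for the annotation s speaks exactly about the i-fragment. A cut on □⁺B is then
handled by an outer induction on the goodness of its right premise and an inner induction on i
(`CutEliminable.good_boxPlus`).

All notions compare two derivations at once and carry a `Mode` of admissible inferences. Therefore
the single statement `CutEliminable` yields every claim: goodness of the result gives an ∞-proof, a
pair of proofs with equal fragments gives non-expansiveness, and the modes without cuts or with slim
inferences give the other two properties. The delicate point is a □⁺B-cut in a tree annotated with
B, because there the right premise of the left-hand □⁺ lies one level higher and is known less well.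
In that case □⁺B occurs in the right-hand side of the conclusion, and the cut is replaced by a
contraction.

The relations are linked to ∞-proofs by `SeqTree.IsProof.good` and `SeqTree.IsProof.frag_leaf` in
one direction, and by `Good.isProof`, `Derives.trunc_render_eq` and `Derives.allowed_of_trunc` in
the other. -/

noncomputable instance : DecidableEq Formula := Classical.decEq _

/-! ### Main trees and pairs of derivations -/

/-- Finite trees of non-modal inferences that end in initial sequents and in modal inferences.
The premises of the modal inferences are represented by elements of `X`. Sequents are omitted: they
are determined by the sequent at the root. -/
inductive MainTree (X : Type) : Type
  | ax : MainTree X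
  | impL : Formula → Formula → MainTree X → MainTree X → MainTree X
  | impR : Formula → Formula → MainTree X → MainTree X
  | cut : Formula → MainTree X → MainTree X → MainTree X
  | box : Formula → Finset Formula → Multiset Formula → Multiset Formula → X → MainTree X
  | boxPlus : Formula → Finset Formula → Multiset Formula → Multiset Formula → X → X → MainTree X

/-- The antecedent of the premises of a modal inference. -/
def premAnt (S₀ : Finset Formula) (L P : Multiset Formula) : Multiset Formula :=
  S₀.val + L + P + P.map Formula.boxPlus

/-- The part of the antecedent of the conclusion of a modal inference that is used by it. -/
def boxedAnt (L P : Multiset Formula) : Multiset Formula :=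
  L.map Formula.box + P.map Formula.boxPlus

/-- Restrictions on the inferences of a derivation: absence of cuts and slimness. -/
structure Mode : Type where
  noCut : Prop
  slim : Prop

/-- Initial sequents. -/
def Initial (Γ Δ : Multiset Formula) : Prop :=
  Formula.bot ∈ Γ ∨ ∃ p, Formula.var p ∈ Γ ∧ Formula.var p ∈ Δ

/-- Side conditions of modal inferences. -/
structure ModalOK (M : Mode) (S : Set Formula) (Γ : Multiset Formula) (S₀ : Finset Formula)
    (L P : Multiset Formula) : Prop where
  sub : (↑S₀ : Set Formula) ⊆ S
  le : boxedAnt L P ≤ Γ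
  slim : M.slim → L.Nodup ∧ P.Nodup

/-- `Derives M ρ S Γ Δ m m'`: the trees `m` and `m'` consist of the same inferences, which are
allowed by `M`, they derive the sequent `S ; Γ ⇒ Δ`, and the representations of the premises of
modal inferences are pairwise related by `ρ`: by `ρ (some A)` for the right premise of `□⁺` with the
principal formula `□⁺ A`, and by `ρ none` for other premises. -/
inductive Derives {X : Type} (M : Mode) (ρ : Annot → Sequent → X → X → Prop) (S : Set Formula) :
    Multiset Formula → Multiset Formula → MainTree X → MainTree X → Prop
  | ax {Γ Δ} (h : Initial Γ Δ) : Derives M ρ S Γ Δ .ax .ax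
  | impL {Γ Γ₀ Δ A B l r l' r'} (e : Γ = Formula.imp A B ::ₘ Γ₀)
      (hl : Derives M ρ S (B ::ₘ Γ₀) Δ l l') (hr : Derives M ρ S Γ₀ (A ::ₘ Δ) r r') :
      Derives M ρ S Γ Δ (.impL A B l r) (.impL A B l' r')
  | impR {Γ Δ Δ₀ A B t t'} (e : Δ = Formula.imp A B ::ₘ Δ₀)
      (h : Derives M ρ S (A ::ₘ Γ) (B ::ₘ Δ₀) t t') :
      Derives M ρ S Γ Δ (.impR A B t) (.impR A B t')
  | cut {Γ Δ A l r l' r'} (hM : ¬ M.noCut)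
      (hl : Derives M ρ S Γ (A ::ₘ Δ) l l') (hr : Derives M ρ S (A ::ₘ Γ) Δ r r') :
      Derives M ρ S Γ Δ (.cut A l r) (.cut A l' r')
  | box {Γ Δ A S₀ L P x x'} (hm : ModalOK M S Γ S₀ L P) (hA : Formula.box A ∈ Δ)
      (hx : ρ none ⟨S, premAnt S₀ L P, {A}⟩ x x') :
      Derives M ρ S Γ Δ (.box A S₀ L P x) (.box A S₀ L P x')
  | boxPlus {Γ Δ A S₀ L P x x' y y'} (hm : ModalOK M S Γ S₀ L P) (hA : Formula.boxPlus A ∈ Δ)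
      (hx : ρ none ⟨S, premAnt S₀ L P, {A}⟩ x x')
      (hy : ρ (some A) ⟨S, premAnt S₀ L P, {Formula.boxPlus A}⟩ y y') :
      Derives M ρ S Γ Δ (.boxPlus A S₀ L P x y) (.boxPlus A S₀ L P x' y')

/-! ### Weakening, inversion and permutation of cuts -/

section Structural

variable {X : Type} {M : Mode} {ρ σ κ : Annot → Sequent → X → X → Prop} {S : Set Formula}
  {Γ Γ' Δ Δ' : Multiset Formula} {m m' p p' q q' : MainTree X} {A B : Formula}

theorem Initial.mono (h : Initial Γ Δ) (hΓ : Γ ≤ Γ') (hΔ : Δ ≤ Δ') : Initial Γ' Δ' := by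
  rcases h with h | ⟨p, h₁, h₂⟩
  · exact Or.inl (Multiset.mem_of_le hΓ h)
  · exact Or.inr ⟨p, Multiset.mem_of_le hΓ h₁, Multiset.mem_of_le hΔ h₂⟩

/-- Initial sequents depend only on ⊥ and variables, so implications can be exchanged freely. This
settles the initial leaves in the inversions. -/
theorem Initial.of_mem (h : Initial Γ Δ) (hΓ : ∀ C ∈ Γ, (∀ A B, C ≠ .imp A B) → C ∈ Γ')
    (hΔ : ∀ C ∈ Δ, (∀ A B, C ≠ .imp A B) → C ∈ Δ') : Initial Γ' Δ' := by
  rcases h with h | ⟨p, h₁, h₂⟩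
  · exact Or.inl (hΓ _ h (by simp))
  · exact Or.inr ⟨p, hΓ _ h₁ (by simp), hΔ _ h₂ (by simp)⟩

theorem Initial.of_cons_right (h : Initial Γ (A ::ₘ Δ)) (hA : ∀ p, A ≠ .var p) : Initial Γ Δ := by
  rcases h with h | ⟨p, h₁, h₂⟩
  · exact Or.inl h
  · exact Or.inr ⟨p, h₁, (Multiset.mem_cons.1 h₂).resolve_left (hA p).symm⟩

theorem imp_notMem_boxedAnt {L P : Multiset Formula} : Formula.imp A B ∉ boxedAnt L P := by
  simp [boxedAnt]

theorem ModalOK.mono {S₀ : Finset Formula} {L P : Multiset Formula}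
    (h : ModalOK M S Γ S₀ L P) (hΓ : Γ ≤ Γ') : ModalOK M S Γ' S₀ L P :=
  ⟨h.sub, h.le.trans hΓ, h.slim⟩

theorem ModalOK.of_cons {S₀ : Finset Formula} {L P : Multiset Formula}
    (h : ModalOK M S (A ::ₘ Γ) S₀ L P) (hA : A ∉ boxedAnt L P) : ModalOK M S Γ S₀ L P :=
  ⟨h.sub, (Multiset.le_cons_of_notMem hA).1 h.le, h.slim⟩

theorem Derives.mono (h : Derives M ρ S Γ Δ m m')
    (hρ : ∀ a c x x', ρ a c x x' → σ a c x x') : Derives M σ S Γ Δ m m' := by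
  induction h with
  | ax h => exact .ax h
  | impL e _ _ hl hr => exact .impL e hl hr
  | impR e _ h => exact .impR e h
  | cut hM _ _ hl hr => exact .cut hM hl hr
  | box hm hA hx => exact .box hm hA (hρ _ _ _ _ hx)
  | boxPlus hm hA hx hy => exact .boxPlus hm hA (hρ _ _ _ _ hx) (hρ _ _ _ _ hy)

/-- Main trees store no side formulas, so the same tree derives the weakened sequent and premises of
modal inferences stay untouched. -/
theorem Derives.weaken (h : Derives M ρ S Γ Δ m m') (hΓ : Γ ≤ Γ') (hΔ : Δ ≤ Δ') :
    Derives M ρ S Γ' Δ' m m' := by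
  obtain ⟨Γ₁, rfl⟩ := Multiset.le_iff_exists_add.1 hΓ
  obtain ⟨Δ₁, rfl⟩ := Multiset.le_iff_exists_add.1 hΔ
  clear hΓ hΔ
  induction h with
  | ax h => exact .ax (h.mono (Multiset.le_add_right _ _) (Multiset.le_add_right _ _))
  | impL e _ _ hl hr =>
    subst e
    exact .impL (Multiset.cons_add _ _ _) (by simpa using hl) (by simpa using hr)
  | impR e _ h =>
    subst e
    exact .impR (Multiset.cons_add _ _ _) (by simpa using h)
  | cut hM _ _ hl hr => exact .cut hM (by simpa using hl) (by simpa using hr)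
  | box hm hA hx =>
    exact .box (hm.mono (Multiset.le_add_right _ _)) (Multiset.mem_add.2 (Or.inl hA)) hx
  | boxPlus hm hA hx hy =>
    exact .boxPlus (hm.mono (Multiset.le_add_right _ _)) (Multiset.mem_add.2 (Or.inl hA)) hx hy

/-- Inversion of the rule `→_R`. -/
noncomputable def MainTree.invR (A B : Formula) : MainTree X → MainTree X
  | .ax => .ax
  | .impL C D l r => .impL C D (l.invR A B) (r.invR A B)
  | .impR C D t => if C = A ∧ D = B then t else .impR C D (t.invR A B)
  | .cut C l r => .cut C (l.invR A B) (r.invR A B)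
  | .box C S₀ L P x => .box C S₀ L P x
  | .boxPlus C S₀ L P x y => .boxPlus C S₀ L P x y

/-- Inversion of the rule `→_L` with respect to the left premise. -/
noncomputable def MainTree.invLL (A B : Formula) : MainTree X → MainTree X
  | .ax => .ax
  | .impL C D l r => if C = A ∧ D = B then l else .impL C D (l.invLL A B) (r.invLL A B)
  | .impR C D t => .impR C D (t.invLL A B)
  | .cut C l r => .cut C (l.invLL A B) (r.invLL A B)
  | .box C S₀ L P x => .box C S₀ L P x
  | .boxPlus C S₀ L P x y => .boxPlus C S₀ L P x y

/-- Inversion of the rule `→_L` with respect to the right premise. -/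
noncomputable def MainTree.invLR (A B : Formula) : MainTree X → MainTree X
  | .ax => .ax
  | .impL C D l r => if C = A ∧ D = B then r else .impL C D (l.invLR A B) (r.invLR A B)
  | .impR C D t => .impR C D (t.invLR A B)
  | .cut C l r => .cut C (l.invLR A B) (r.invLR A B)
  | .box C S₀ L P x => .box C S₀ L P x
  | .boxPlus C S₀ L P x y => .boxPlus C S₀ L P x y

/-- Each path is shortened at the first inference with the principal formula A → B. Testing the
formula suffices, since equal occurrences in a multiset are interchangeable. Modal inferences absorb
the new side formulas. -/
theorem Derives.invR (h : Derives M ρ S Γ (Formula.imp A B ::ₘ Δ) m m') :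
    Derives M ρ S (A ::ₘ Γ) (B ::ₘ Δ) (m.invR A B) (m'.invR A B) := by
  generalize e : Formula.imp A B ::ₘ Δ = Δ' at h
  induction h generalizing Δ with
  | ax h =>
    subst e
    exact .ax (h.of_mem (by simp +contextual) (by simp +contextual))
  | impL e' _ _ hl hr =>
    subst e e'
    refine .impL (Multiset.cons_swap _ _ _) ?_ ?_
    · rw [Multiset.cons_swap]; exact hl rfl
    · rw [Multiset.cons_swap]; exact hr (Multiset.cons_swap _ _ _)
  | @impR Γ Δ' Δ₀ C D t t' e' h ih =>
    subst e
    simp only [MainTree.invR]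
    rcases Multiset.cons_eq_cons.1 e' with ⟨h₁, rfl⟩ | ⟨h₁, Δ₁, rfl, rfl⟩
    · cases h₁
      simpa using h
    · rw [if_neg (by rintro ⟨rfl, rfl⟩; exact h₁ rfl), if_neg (by rintro ⟨rfl, rfl⟩; exact h₁ rfl)]
      refine .impR (Multiset.cons_swap _ _ _) ?_
      rw [Multiset.cons_swap, Multiset.cons_swap _ B]
      exact ih (Multiset.cons_swap _ _ _)
  | cut hM _ _ hl hr =>
    subst e
    refine .cut hM ?_ ?_
    · rw [Multiset.cons_swap]; exact hl (Multiset.cons_swap _ _ _)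
    · rw [Multiset.cons_swap]; exact hr rfl
  | box hm hA hx =>
    subst e
    exact .box (hm.mono (Multiset.le_cons_self _ _))
      (Multiset.mem_cons_of_mem (by simpa using hA)) hx
  | boxPlus hm hA hx hy =>
    subst e
    exact .boxPlus (hm.mono (Multiset.le_cons_self _ _))
      (Multiset.mem_cons_of_mem (by simpa using hA)) hx hy

theorem Derives.invLL (h : Derives M ρ S (Formula.imp A B ::ₘ Γ) Δ m m') :
    Derives M ρ S (B ::ₘ Γ) Δ (m.invLL A B) (m'.invLL A B) := by
  generalize e : Formula.imp A B ::ₘ Γ = Γ' at h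
  induction h generalizing Γ with
  | ax h =>
    subst e
    exact .ax (h.of_mem (by simp +contextual) (by simp +contextual))
  | @impL Γ' Γ₀ Δ C D l r l' r' e' hl hr ihl ihr =>
    subst e
    simp only [MainTree.invLL]
    rcases Multiset.cons_eq_cons.1 e' with ⟨h₁, rfl⟩ | ⟨h₁, Γ₁, rfl, rfl⟩
    · cases h₁
      simpa using hl
    · rw [if_neg (by rintro ⟨rfl, rfl⟩; exact h₁ rfl), if_neg (by rintro ⟨rfl, rfl⟩; exact h₁ rfl)]
      refine .impL (Multiset.cons_swap _ _ _) ?_ (ihr rfl)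
      rw [Multiset.cons_swap]
      exact ihl (Multiset.cons_swap _ _ _)
  | impR e' _ h =>
    subst e e'
    refine .impR rfl ?_
    rw [Multiset.cons_swap]
    exact h (Multiset.cons_swap _ _ _)
  | cut hM _ _ hl hr =>
    subst e
    refine .cut hM (hl rfl) ?_
    rw [Multiset.cons_swap]; exact hr (Multiset.cons_swap _ _ _)
  | box hm hA hx =>
    subst e
    exact .box ((hm.of_cons imp_notMem_boxedAnt).mono (Multiset.le_cons_self _ _)) hA hx
  | boxPlus hm hA hx hy =>
    subst e
    exact .boxPlus ((hm.of_cons imp_notMem_boxedAnt).mono (Multiset.le_cons_self _ _)) hA hx hy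

theorem Derives.invLR (h : Derives M ρ S (Formula.imp A B ::ₘ Γ) Δ m m') :
    Derives M ρ S Γ (A ::ₘ Δ) (m.invLR A B) (m'.invLR A B) := by
  generalize e : Formula.imp A B ::ₘ Γ = Γ' at h
  induction h generalizing Γ with
  | ax h =>
    subst e
    exact .ax (h.of_mem (by simp +contextual) (by simp +contextual))
  | @impL Γ' Γ₀ Δ C D l r l' r' e' hl hr ihl ihr =>
    subst e
    simp only [MainTree.invLR]
    rcases Multiset.cons_eq_cons.1 e' with ⟨h₁, rfl⟩ | ⟨h₁, Γ₁, rfl, rfl⟩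
    · cases h₁
      simpa using hr
    · rw [if_neg (by rintro ⟨rfl, rfl⟩; exact h₁ rfl), if_neg (by rintro ⟨rfl, rfl⟩; exact h₁ rfl)]
      refine .impL rfl (ihl (Multiset.cons_swap _ _ _)) ?_
      rw [Multiset.cons_swap]
      exact ihr rfl
  | impR e' _ h =>
    subst e e'
    refine .impR (Multiset.cons_swap _ _ _) ?_
    rw [Multiset.cons_swap]
    exact h (Multiset.cons_swap _ _ _)
  | cut hM _ _ hl hr =>
    subst e
    refine .cut hM ?_ (hr (Multiset.cons_swap _ _ _))
    rw [Multiset.cons_swap]; exact hl rfl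
  | box hm hA hx =>
    subst e
    exact .box (hm.of_cons imp_notMem_boxedAnt) (Multiset.mem_cons_of_mem hA) hx
  | boxPlus hm hA hx hy =>
    subst e
    exact .boxPlus (hm.of_cons imp_notMem_boxedAnt) (Multiset.mem_cons_of_mem hA) hx hy

/-- A formula that is neither an implication nor used by an inference can be removed from the
right-hand side. -/
theorem Derives.erase_right (h : Derives M ρ S Γ (A ::ₘ Δ) m m')
    (hA : A = Formula.bot ∨ (∀ C D, A ≠ .imp C D) ∧ A ∈ Δ) : Derives M ρ S Γ Δ m m' := by
  generalize e : A ::ₘ Δ = Δ' at h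
  have hA' : ∀ C D, A ≠ .imp C D := by
    rcases hA with rfl | h
    · simp
    · exact h.1
  -- This invariant covers both cases of `hA` and passes to premises. The formulas that leaves use
  -- on the right are never ⊥, so each leaf still finds its formula in Δ.
  have key : ∀ C, C ∈ A ::ₘ Δ → C ≠ .bot → C ∈ Δ := by
    intro C hC hb
    rcases Multiset.mem_cons.1 hC with rfl | hC
    · rcases hA with rfl | h
      · exact absurd rfl hb
      · exact h.2
    · exact hC
  clear hA
  induction h generalizing Δ with
  | ax h =>
    subst e
    rcases h with h | ⟨p, h₁, h₂⟩
    · exact .ax (Or.inl h)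
    · exact .ax (Or.inr ⟨p, h₁, key _ h₂ (by simp)⟩)
  | impL e' _ _ hl hr =>
    subst e
    refine .impL e' (hl rfl key) (hr (Multiset.cons_swap _ _ _) ?_)
    intro C hC hb
    rw [Multiset.cons_swap, Multiset.mem_cons] at hC
    exact Multiset.mem_cons.2 (hC.imp_right fun h => key C h hb)
  | @impR Γ Δ' Δ₀ C D t t' e' h ih =>
    subst e
    rcases Multiset.cons_eq_cons.1 e' with ⟨h₁, rfl⟩ | ⟨h₁, Δ₁, rfl, rfl⟩
    · exact absurd h₁ (hA' _ _)
    · refine .impR rfl (ih (Multiset.cons_swap _ _ _) ?_)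
      intro E hE hb
      rw [Multiset.cons_swap, Multiset.mem_cons] at hE
      refine Multiset.mem_cons.2 (hE.imp_right fun h => ?_)
      rcases Multiset.mem_cons.1 h with rfl | h
      -- The remaining copy of the erased formula is not the principal implication, hence it
      -- survives in the premise.
      · have := key E (Multiset.mem_cons_self _ _) hb
        exact (Multiset.mem_cons.1 this).resolve_left h₁
      · exact h
  | cut hM _ _ hl hr =>
    subst e
    refine .cut hM (hl (Multiset.cons_swap _ _ _) ?_) (hr rfl key)
    intro C hC hb
    rw [Multiset.cons_swap, Multiset.mem_cons] at hC
    exact Multiset.mem_cons.2 (hC.imp_right fun h => key C h hb)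
  | box hm hA hx => subst e; exact .box hm (key _ hA (by simp)) hx
  | boxPlus hm hA hx hy => subst e; exact .boxPlus hm (key _ hA (by simp)) hx hy

/-- A variable can be removed from the left-hand side if it does not influence initial sequents. -/
theorem Derives.erase_var_left {n : ℕ} (h : Derives M ρ S (Formula.var n ::ₘ Γ) Δ m m')
    (hn : Initial Γ (Formula.var n ::ₘ Δ)) : Derives M ρ S Γ Δ m m' := by
  generalize e : Formula.var n ::ₘ Γ = Γ' at h
  induction h generalizing Γ with
  | ax h =>
    subst e
    refine .ax ?_
    rcases h with h | ⟨p, h₁, h₂⟩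
    · exact Or.inl (by simpa using h)
    -- If the leaf uses the erased variable, `hn` provides another occurrence on the left or a
    -- reason to be initial that does not involve it.
    · by_cases hp : p = n
      · subst hp
        rcases hn with h | ⟨k, h₃, h₄⟩
        · exact Or.inl h
        · rcases Multiset.mem_cons.1 h₄ with h | h
          · cases h; exact Or.inr ⟨p, h₃, h₂⟩
          · exact Or.inr ⟨k, h₃, h⟩
      · exact Or.inr ⟨p, by simpa [hp] using h₁, h₂⟩
  | impL e' _ _ hl hr =>
    subst e
    obtain ⟨h₁, -⟩ | ⟨h₁, Γ₁, rfl, rfl⟩ := Multiset.cons_eq_cons.1 e'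
    · cases h₁
    · refine .impL rfl (hl ?_ (Multiset.cons_swap _ _ _)) (hr ?_ rfl)
      · exact hn.of_mem (by simp +contextual) (by simp +contextual)
      · exact hn.of_mem (by simp +contextual) (by simp +contextual)
  | impR e' _ h =>
    subst e e'
    exact .impR rfl (h (hn.of_mem (by simp +contextual) (by simp +contextual))
      (Multiset.cons_swap _ _ _))
  | cut hM _ _ hl hr =>
    subst e
    exact .cut hM (hl (hn.mono le_rfl (by simp [Multiset.le_cons_self])) rfl)
      (hr (hn.mono (Multiset.le_cons_self _ _) le_rfl) (Multiset.cons_swap _ _ _))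
  | box hm hA hx => subst e; exact .box (hm.of_cons (by simp [boxedAnt])) hA hx
  | boxPlus hm hA hx hy => subst e; exact .boxPlus (hm.of_cons (by simp [boxedAnt])) hA hx hy

/-- The trees without non-modal inferences. -/
def MainTree.IsLeaf : MainTree X → Prop
  | .ax => True
  | .box .. => True
  | .boxPlus .. => True
  | _ => False

/-- Permutation of a cut with premises `p` and `q` upwards over the non-modal inferences of `p`. -/
noncomputable def MainTree.permute (k : MainTree X → MainTree X → MainTree X) :
    MainTree X → MainTree X → MainTree X
  | .ax, q => k .ax q
  | .impL A B l r, q => .impL A B (l.permute k (q.invLL A B)) (r.permute k (q.invLR A B))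
  | .impR A B t, q => .impR A B (t.permute k (q.invR A B))
  | .cut A l r, q => .cut A (l.permute k q) (r.permute k q)
  | .box A S₀ L P x, q => k (.box A S₀ L P x) q
  | .boxPlus A S₀ L P x y, q => k (.boxPlus A S₀ L P x y) q

/-- The implication rules are invertible, so q is inverted along the left tree and the cut moves
into the premises; at a cut of the left tree, q is weakened instead. The cut formula must not be an
implication, as it could then be principal in →_R. Three relations are needed because the premises
of the two trees may be known to different extents. -/
theorem Derives.permute {k : MainTree X → MainTree X → MainTree X} (hA : ∀ B C, A ≠ .imp B C)
    (hp : Derives M ρ S Γ (A ::ₘ Δ) p p') (hq : Derives M σ S (A ::ₘ Γ) Δ q q')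
    (hk : ∀ {Γ Δ p p' q q'}, p.IsLeaf → Derives M ρ S Γ (A ::ₘ Δ) p p' →
      Derives M σ S (A ::ₘ Γ) Δ q q' → Derives M κ S Γ Δ (k p q) (k p' q')) :
    Derives M κ S Γ Δ (p.permute k q) (p'.permute k q') := by
  generalize e : A ::ₘ Δ = Δ' at hp
  induction hp generalizing Δ q q' with
  | ax h => subst e; exact hk trivial (.ax h) hq
  | impL e' _ _ hl hr =>
    subst e e'
    rw [Multiset.cons_swap] at hq
    refine .impL rfl (hl ?_ rfl) (hr hq.invLR (Multiset.cons_swap _ _ _))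
    rw [Multiset.cons_swap]; exact hq.invLL
  | @impR Γ Δ' Δ₀ C D t t' e' h ih =>
    subst e
    rcases Multiset.cons_eq_cons.1 e' with ⟨h₁, rfl⟩ | ⟨h₁, Δ₁, rfl, rfl⟩
    · exact absurd h₁ (hA _ _)
    · refine .impR rfl (ih ?_ (Multiset.cons_swap _ _ _))
      rw [Multiset.cons_swap]; exact hq.invR
  | cut hM _ _ hl hr =>
    subst e
    refine .cut hM (hl (hq.weaken le_rfl (Multiset.le_cons_self _ _)) (Multiset.cons_swap _ _ _))
      (hr (hq.weaken ?_ le_rfl) rfl)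
    rw [Multiset.cons_swap]; exact Multiset.le_cons_self _ _
  | box hm hB hx => subst e; exact hk trivial (.box hm hB hx) hq
  | boxPlus hm hB hx hy => subst e; exact hk trivial (.boxPlus hm hB hx hy) hq

/-- Replacement of the modal inferences of a tree. -/
def MainTree.mapModal (k : MainTree X → MainTree X) : MainTree X → MainTree X
  | .ax => .ax
  | .impL A B l r => .impL A B (l.mapModal k) (r.mapModal k)
  | .impR A B t => .impR A B (t.mapModal k)
  | .cut A l r => .cut A (l.mapModal k) (r.mapModal k)
  | .box A S₀ L P x => k (.box A S₀ L P x)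
  | .boxPlus A S₀ L P x y => k (.boxPlus A S₀ L P x y)

/-- Permutation of a cut, whose left premise ends with a modal inference that uses `boxedAnt L P`,
over the non-modal inferences of the right premise. -/
theorem Derives.mapModal {k k' : MainTree X → MainTree X} {L P : Multiset Formula}
    (hA : A ∈ boxedAnt {B} {B})
    (hΓ : boxedAnt L P ≤ Γ) (hq : Derives M σ S (A ::ₘ Γ) Δ q q')
    (hk : ∀ {Γ Δ q q'}, q.IsLeaf → q ≠ .ax → boxedAnt L P ≤ Γ →
      Derives M σ S (A ::ₘ Γ) Δ q q' → Derives M κ S Γ Δ (k q) (k' q')) :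
    Derives M κ S Γ Δ (q.mapModal k) (q'.mapModal k') := by
  have hA : A = .box B ∨ A = .boxPlus B := by simpa [boxedAnt] using hA
  generalize e : A ::ₘ Γ = Γ' at hq
  -- Only `boxedAnt L P ≤ Γ` has to be maintained: a modal left premise survives any other change of
  -- side formulas, so it need not be inverted.
  induction hq generalizing Γ with
  | ax h =>
    subst e
    refine .ax ?_
    rcases h with h | ⟨p, h₁, h₂⟩
    · exact Or.inl (by rcases hA with rfl | rfl <;> simpa using h)
    · exact Or.inr ⟨p, by rcases hA with rfl | rfl <;> simpa using h₁, h₂⟩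
  | impL e' _ _ hl hr =>
    subst e
    obtain ⟨h₁, -⟩ | ⟨h₁, Γ₁, rfl, rfl⟩ := Multiset.cons_eq_cons.1 e'
    · subst h₁; simp at hA
    · have hΓ₁ := (Multiset.le_cons_of_notMem imp_notMem_boxedAnt).1 hΓ
      exact .impL rfl (hl (hΓ₁.trans (Multiset.le_cons_self _ _)) (Multiset.cons_swap _ _ _))
        (hr hΓ₁ rfl)
  | impR e' _ h =>
    subst e e'
    exact .impR rfl (h (hΓ.trans (Multiset.le_cons_self _ _)) (Multiset.cons_swap _ _ _))
  | cut hM _ _ hl hr =>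
    subst e
    exact .cut hM (hl hΓ rfl)
      (hr (hΓ.trans (Multiset.le_cons_self _ _)) (Multiset.cons_swap _ _ _))
  | box hm hB hx => subst e; exact hk trivial (by simp) hΓ (.box hm hB hx)
  | boxPlus hm hB hx hy => subst e; exact hk trivial (by simp) hΓ (.boxPlus hm hB hx hy)

/-- An intersection property of `Derives`. -/
theorem Derives.forall_nat {τ : ℕ → Annot → Sequent → X → X → Prop}
    (h : ∀ i, Derives M (τ i) S Γ Δ m m') :
    Derives M (fun a c x x' => ∀ i, τ i a c x x') S Γ Δ m m' := by
  -- The trees record rules and principal formulas, so all the derivations `h i` pass through the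
  -- same sequents and the derivation for 0 can guide the induction.
  have h₀ := h 0
  induction h₀ with
  | ax hi => exact .ax hi
  | impL e _ _ hl hr =>
    subst e
    refine .impL rfl (hl fun i => ?_) (hr fun i => ?_) <;>
    · cases h i with | impL e hl hr => ?_
      rw [Multiset.cons_inj_right] at e
      subst e
      assumption
  | impR e _ ih =>
    subst e
    refine .impR rfl (ih fun i => ?_)
    cases h i with | impR e h => ?_
    rw [Multiset.cons_inj_right] at e
    subst e
    assumption
  | cut hM _ _ hl hr =>
    refine .cut hM (hl fun i => ?_) (hr fun i => ?_) <;>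
    · cases h i
      assumption
  | box hm hA hx => exact .box hm hA fun i => by cases h i; assumption
  | boxPlus hm hA hx hy =>
    exact .boxPlus hm hA (fun i => by cases h i; assumption) (fun i => by cases h i; assumption)

end Structural

/-! ### Side conditions of merged modal inferences -/

section Merge

variable {M : Mode} {S : Set Formula} {Γ : Multiset Formula} {B : Formula}
  {S₀ S₁ : Finset Formula} {L P L₁ P₁ : Multiset Formula}

theorem count_box_boxedAnt (A : Formula) :
    (boxedAnt L P).count (Formula.box A) = L.count A := by
  have h : (P.map Formula.boxPlus).count (Formula.box A) = 0 :=
    Multiset.count_eq_zero.2 (by simp)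
  rw [boxedAnt, Multiset.count_add, h, add_zero]
  exact Multiset.count_map_eq_count' _ _ (fun _ _ h => by cases h; rfl) _

theorem count_boxPlus_boxedAnt (A : Formula) :
    (boxedAnt L P).count (Formula.boxPlus A) = P.count A := by
  have h : (L.map Formula.box).count (Formula.boxPlus A) = 0 :=
    Multiset.count_eq_zero.2 (by simp)
  rw [boxedAnt, Multiset.count_add, h, zero_add]
  exact Multiset.count_map_eq_count' _ _ (fun _ _ h => by cases h; rfl) _

theorem boxedAnt_le_iff : boxedAnt L P ≤ Γ ↔
    (∀ A, L.count A ≤ Γ.count (Formula.box A)) ∧ ∀ A, P.count A ≤ Γ.count (Formula.boxPlus A) := by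
  rw [Multiset.le_iff_count]
  constructor
  · intro h
    refine ⟨fun A => ?_, fun A => ?_⟩
    · rw [← count_box_boxedAnt (P := P)]; exact h _
    · rw [← count_boxPlus_boxedAnt (L := L)]; exact h _
  · rintro ⟨h₁, h₂⟩ A
    by_cases hA : A ∈ boxedAnt L P
    · simp only [boxedAnt, Multiset.mem_add, Multiset.mem_map] at hA
      rcases hA with ⟨C, -, rfl⟩ | ⟨C, -, rfl⟩
      · rw [count_box_boxedAnt]; exact h₁ _
      · rw [count_boxPlus_boxedAnt]; exact h₂ _
    · rw [Multiset.count_eq_zero.2 hA]; exact Nat.zero_le _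

/-- Multiplicities are combined by maximum, not by sum: both boxed parts lie in the same Γ, where a
sum might not fit, and the maximum creates no repetitions. Non-fattening rests on this. -/
theorem ModalOK.union (h₀ : ModalOK M S Γ S₀ L P) (h₁ : ModalOK M S Γ S₁ L₁ P₁) :
    ModalOK M S Γ (S₀ ∪ S₁) (L ∪ L₁) (P ∪ P₁) := by
  refine ⟨?_, ?_, fun hs => ?_⟩
  · rw [Finset.coe_union]; exact Set.union_subset h₀.sub h₁.sub
  · have h₂ := boxedAnt_le_iff.1 h₀.le
    have h₃ := boxedAnt_le_iff.1 h₁.le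
    refine boxedAnt_le_iff.2 ⟨fun A => ?_, fun A => ?_⟩
    · rw [Multiset.count_union]; exact max_le (h₂.1 A) (h₃.1 A)
    · rw [Multiset.count_union]; exact max_le (h₂.2 A) (h₃.2 A)
  · exact ⟨Multiset.nodup_union.2 ⟨(h₀.slim hs).1, (h₁.slim hs).1⟩,
      Multiset.nodup_union.2 ⟨(h₀.slim hs).2, (h₁.slim hs).2⟩⟩

theorem ModalOK.of_box (h : ModalOK M S (Formula.box B ::ₘ Γ) S₀ (B ::ₘ L) P) :
    ModalOK M S Γ S₀ L P := by
  refine ⟨h.sub, ?_, fun hs => ⟨(Multiset.nodup_cons.1 (h.slim hs).1).2, (h.slim hs).2⟩⟩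
  have := h.le
  rw [boxedAnt, Multiset.map_cons, Multiset.cons_add] at this
  exact (Multiset.cons_le_cons_iff _).1 this

theorem ModalOK.of_boxPlus (h : ModalOK M S (Formula.boxPlus B ::ₘ Γ) S₀ L (B ::ₘ P)) :
    ModalOK M S Γ S₀ L P := by
  refine ⟨h.sub, ?_, fun hs => ⟨(h.slim hs).1, (Multiset.nodup_cons.1 (h.slim hs).2).2⟩⟩
  have := h.le
  rw [boxedAnt, Multiset.map_cons, Multiset.add_cons] at this
  exact (Multiset.cons_le_cons_iff _).1 this

theorem premAnt_mono (h₀ : S₀ ⊆ S₁) (hL : L ≤ L₁) (hP : P ≤ P₁) :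
    premAnt S₀ L P ≤ premAnt S₁ L₁ P₁ :=
  add_le_add (add_le_add (add_le_add (Finset.val_le_iff.2 h₀) hL) hP) (Multiset.map_le_map hP)

theorem premAnt_cons_left : premAnt S₀ (B ::ₘ L) P = B ::ₘ premAnt S₀ L P := by
  simp [premAnt]

theorem premAnt_cons_right :
    premAnt S₀ L (B ::ₘ P) = Formula.boxPlus B ::ₘ B ::ₘ premAnt S₀ L P := by
  simp only [premAnt, Multiset.map_cons, Multiset.add_cons, Multiset.cons_add]

end Merge

/-! ### Reduction of a cut on main trees -/

/-- Terms built from trees by pending eliminations of cuts: `elim A Δ t u` stands for the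
elimination of the cut with the premises `t`, `u` and the cut formula `A`, where `Δ` is the
right-hand side of the conclusion. -/
inductive CutTerm : Type
  | leaf : SeqTree → CutTerm
  | elim : Formula → Multiset Formula → CutTerm → CutTerm → CutTerm

namespace MainTree

/-- The elimination of the cut with the cut formula `□ B` whose left premise is obtained by the
rule `□`, where the right premise is a modal inference. -/
noncomputable def mergeBox (B : Formula) (S₀ : Finset Formula) (L P : Multiset Formula)
    (x : CutTerm) : MainTree CutTerm → MainTree CutTerm
  | .box A S₁ L₁ P₁ y =>
    if B ∈ L₁ then .box A (S₀ ∪ S₁) (L ∪ L₁.erase B) (P ∪ P₁) (.elim B {A} x y)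
    -- Here the cut formula is only a side formula of the right inference, and the left premise is
    -- not needed.
    else .box A S₁ L₁ P₁ y
  | .boxPlus A S₁ L₁ P₁ y z =>
    if B ∈ L₁ then .boxPlus A (S₀ ∪ S₁) (L ∪ L₁.erase B) (P ∪ P₁) (.elim B {A} x y)
      (.elim B {Formula.boxPlus A} x z)
    else .boxPlus A S₁ L₁ P₁ y z
  | m => m

/-- The premise obtained by the elimination of two cuts with the cut formulas `□⁺ B` and `B`. -/
def elimTwo (B : Formula) (x x₁ : CutTerm) (C : Formula) (y : CutTerm) : CutTerm :=
  .elim B {C} x (.elim (Formula.boxPlus B) {C} x₁ y)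

/-- The elimination of the cut with the cut formula `□⁺ B` whose left premise is obtained by the
rule `□⁺`, where the right premise is a modal inference. -/
noncomputable def mergeBoxPlus (B : Formula) (S₀ : Finset Formula) (L P : Multiset Formula)
    (x x₁ : CutTerm) : MainTree CutTerm → MainTree CutTerm
  | .box A S₁ L₁ P₁ y =>
    if B ∈ P₁ then .box A (S₀ ∪ S₁) (L ∪ L₁) (P ∪ P₁.erase B) (elimTwo B x x₁ A y)
    else .box A S₁ L₁ P₁ y
  | .boxPlus A S₁ L₁ P₁ y z =>
    if B ∈ P₁ then .boxPlus A (S₀ ∪ S₁) (L ∪ L₁) (P ∪ P₁.erase B) (elimTwo B x x₁ A y)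
      (elimTwo B x x₁ (Formula.boxPlus A) z)
    else .boxPlus A S₁ L₁ P₁ y z
  | m => m

/-- The elimination of the cut with the cut formula `□ B` whose left premise is initial or modal. -/
noncomputable def reduceBox (B : Formula) : MainTree CutTerm → MainTree CutTerm → MainTree CutTerm
  | .box A S₀ L P x, q =>
    if A = B then q.mapModal (mergeBox B S₀ L P x) else .box A S₀ L P x
  | p, _ => p

/-- The elimination of the cut with the cut formula `□⁺ B` whose left premise is initial or
modal. -/
noncomputable def reduceBoxPlus (B : Formula) :
    MainTree CutTerm → MainTree CutTerm → MainTree CutTerm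
  | .boxPlus A S₀ L P x x₁, q =>
    if A = B then q.mapModal (mergeBoxPlus B S₀ L P x x₁) else .boxPlus A S₀ L P x x₁
  | p, _ => p

/-- The elimination of the cut whose cut formula is a variable and whose left premise is initial or
modal. -/
def reduceVar : MainTree CutTerm → MainTree CutTerm → MainTree CutTerm
  | .ax, q => q
  | p, _ => p

/-- The elimination of a cut above the modal inferences that are the nearest to the root. -/
noncomputable def elimCut : Formula → Multiset Formula →
    MainTree CutTerm → MainTree CutTerm → MainTree CutTerm
  | .var _, _, p, q => p.permute reduceVar q
  | .bot, _, p, _ => p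
  -- The inner cut, on A, leads to Γ ⇒ B, Δ, and the outer cut removes B. Both act at once on main
  -- trees, without pending cuts.
  | .imp A B, Δ, p, q =>
    elimCut B Δ (elimCut A (B ::ₘ Δ) (q.invLR A B) (p.invR A B)) (q.invLL A B)
  | .box B, _, p, q => p.permute (reduceBox B) q
  | .boxPlus B, Δ, p, q =>
    -- With another copy of □⁺B in Δ the left premise is contracted instead. In the other case B is
    -- not a possible annotation of the conclusion, which is what the reduction needs to respect
    -- fragments.
    if Formula.boxPlus B ∈ Δ then p else p.permute (reduceBoxPlus B) q

end MainTree

section Reduce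

open MainTree

variable {M : Mode} {ρ σ κ : Annot → Sequent → CutTerm → CutTerm → Prop} {S : Set Formula}
  {Γ Δ : Multiset Formula} {p p' q q' : MainTree CutTerm} {B : Formula}

theorem none_mem_Ann (c : Sequent) : (none : Annot) ∈ c.Ann := by
  intro A h; cases h

theorem some_mem_Ann_singleton (S : Set Formula) (Γ : Multiset Formula) (A : Formula) :
    (some A : Annot) ∈ (Sequent.mk S Γ {Formula.boxPlus A}).Ann := by
  intro C h; cases h; simp

theorem Derives.reduceVar {n : ℕ} (hl : p.IsLeaf)
    (hp : Derives M ρ S Γ (Formula.var n ::ₘ Δ) p p')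
    (hq : Derives M ρ S (Formula.var n ::ₘ Γ) Δ q q') :
    Derives M ρ S Γ Δ (reduceVar p q) (reduceVar p' q') := by
  cases hp with
  | ax h => exact hq.erase_var_left h
  | box hm hA hx => exact .box hm (by simpa using hA) hx
  | boxPlus hm hA hx hy => exact .boxPlus hm (by simpa using hA) hx hy
  | impL => exact hl.elim
  | impR => exact hl.elim
  | cut => exact hl.elim

/-- Up to weakening, y has the merged antecedent together with B, so cutting B against x gives a
premise of the merged inference. The hypothesis `H` isolates what this pending cut must satisfy; the
bound on `a` is there so that a statement about annotated trees can discharge it. -/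
theorem Derives.mergeBox {S₀ : Finset Formula} {L P : Multiset Formula} {x x' : CutTerm}
    (hσ : ∀ a c t t', σ a c t t' → κ a c t t')
    (H : ∀ a Θ₁ Θ C y y', a ∈ (Sequent.mk S Θ {C}).Ann → premAnt S₀ L P ≤ Θ → Θ₁ ≤ B ::ₘ Θ →
      σ a ⟨S, Θ₁, {C}⟩ y y' → κ a ⟨S, Θ, {C}⟩ (.elim B {C} x y) (.elim B {C} x' y'))
    (hm : ModalOK M S Γ S₀ L P) (hl : q.IsLeaf)
    (hq : Derives M σ S (Formula.box B ::ₘ Γ) Δ q q') (hax : q ≠ .ax) :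
    Derives M κ S Γ Δ (q.mergeBox B S₀ L P x) (q'.mergeBox B S₀ L P x') := by
  have hle : ∀ {S₁ : Finset Formula} {L₁ P₁ : Multiset Formula}, premAnt S₁ (B ::ₘ L₁) P₁ ≤
      B ::ₘ premAnt (S₀ ∪ S₁) (L ∪ L₁) (P ∪ P₁) := fun {S₁ L₁ P₁} => by
    rw [premAnt_cons_left]
    exact Multiset.cons_le_cons _ (premAnt_mono Finset.subset_union_right
      Multiset.le_union_right Multiset.le_union_right)
  have hle₀ : ∀ {S₁ : Finset Formula} {L₁ P₁ : Multiset Formula}, premAnt S₀ L P ≤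
      premAnt (S₀ ∪ S₁) (L ∪ L₁) (P ∪ P₁) := premAnt_mono Finset.subset_union_left
      Multiset.le_union_left Multiset.le_union_left
  cases hq with
  | ax h => exact absurd rfl hax
  | @box _ _ A S₁ L₁ P₁ y y' hm₁ hA hy =>
    by_cases hB : B ∈ L₁
    · obtain ⟨L₂, rfl⟩ := Multiset.exists_cons_of_mem hB
      simp only [MainTree.mergeBox, hB, if_true, Multiset.erase_cons_head]
      exact .box (hm.union hm₁.of_box) hA (H _ _ _ _ _ _ (none_mem_Ann _) hle₀ hle hy)
    · simp only [MainTree.mergeBox, hB, if_false]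
      exact .box (hm₁.of_cons (by simpa [boxedAnt] using hB)) hA (hσ _ _ _ _ hy)
  | @boxPlus _ _ A S₁ L₁ P₁ y y' z z' hm₁ hA hy hz =>
    by_cases hB : B ∈ L₁
    · obtain ⟨L₂, rfl⟩ := Multiset.exists_cons_of_mem hB
      simp only [MainTree.mergeBox, hB, if_true, Multiset.erase_cons_head]
      exact .boxPlus (hm.union hm₁.of_box) hA (H _ _ _ _ _ _ (none_mem_Ann _) hle₀ hle hy)
        (H _ _ _ _ _ _ (some_mem_Ann_singleton _ _ _) hle₀ hle hz)
    · simp only [MainTree.mergeBox, hB, if_false]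
      exact .boxPlus (hm₁.of_cons (by simpa [boxedAnt] using hB)) hA (hσ _ _ _ _ hy)
        (hσ _ _ _ _ hz)
  | impL => exact hl.elim
  | impR => exact hl.elim
  | cut => exact hl.elim

/-- A boxed □⁺B contributes both □⁺B and B to the premises, hence the two nested cuts of `elimTwo`.
-/
theorem Derives.mergeBoxPlus {S₀ : Finset Formula} {L P : Multiset Formula} {x x' x₁ x₁' : CutTerm}
    (hσ : ∀ a c t t', σ a c t t' → κ a c t t')
    (H : ∀ a Θ₁ Θ C y y', a ∈ (Sequent.mk S Θ {C}).Ann → premAnt S₀ L P ≤ Θ →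
      Θ₁ ≤ Formula.boxPlus B ::ₘ B ::ₘ Θ → σ a ⟨S, Θ₁, {C}⟩ y y' →
      κ a ⟨S, Θ, {C}⟩ (elimTwo B x x₁ C y) (elimTwo B x' x₁' C y'))
    (hm : ModalOK M S Γ S₀ L P) (hl : q.IsLeaf)
    (hq : Derives M σ S (Formula.boxPlus B ::ₘ Γ) Δ q q') (hax : q ≠ .ax) :
    Derives M κ S Γ Δ (q.mergeBoxPlus B S₀ L P x x₁) (q'.mergeBoxPlus B S₀ L P x' x₁') := by
  have hle : ∀ {S₁ : Finset Formula} {L₁ P₁ : Multiset Formula}, premAnt S₁ L₁ (B ::ₘ P₁) ≤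
      Formula.boxPlus B ::ₘ B ::ₘ premAnt (S₀ ∪ S₁) (L ∪ L₁) (P ∪ P₁) := fun {S₁ L₁ P₁} => by
    rw [premAnt_cons_right]
    exact Multiset.cons_le_cons _ (Multiset.cons_le_cons _ (premAnt_mono Finset.subset_union_right
      Multiset.le_union_right Multiset.le_union_right))
  have hle₀ : ∀ {S₁ : Finset Formula} {L₁ P₁ : Multiset Formula}, premAnt S₀ L P ≤
      premAnt (S₀ ∪ S₁) (L ∪ L₁) (P ∪ P₁) := premAnt_mono Finset.subset_union_left
      Multiset.le_union_left Multiset.le_union_left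
  cases hq with
  | ax h => exact absurd rfl hax
  | @box _ _ A S₁ L₁ P₁ y y' hm₁ hA hy =>
    by_cases hB : B ∈ P₁
    · obtain ⟨P₂, rfl⟩ := Multiset.exists_cons_of_mem hB
      simp only [MainTree.mergeBoxPlus, hB, if_true, Multiset.erase_cons_head]
      exact .box (hm.union hm₁.of_boxPlus) hA (H _ _ _ _ _ _ (none_mem_Ann _) hle₀ hle hy)
    · simp only [MainTree.mergeBoxPlus, hB, if_false]
      exact .box (hm₁.of_cons (by simpa [boxedAnt] using hB)) hA (hσ _ _ _ _ hy)
  | @boxPlus _ _ A S₁ L₁ P₁ y y' z z' hm₁ hA hy hz =>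
    by_cases hB : B ∈ P₁
    · obtain ⟨P₂, rfl⟩ := Multiset.exists_cons_of_mem hB
      simp only [MainTree.mergeBoxPlus, hB, if_true, Multiset.erase_cons_head]
      exact .boxPlus (hm.union hm₁.of_boxPlus) hA (H _ _ _ _ _ _ (none_mem_Ann _) hle₀ hle hy)
        (H _ _ _ _ _ _ (some_mem_Ann_singleton _ _ _) hle₀ hle hz)
    · simp only [MainTree.mergeBoxPlus, hB, if_false]
      exact .boxPlus (hm₁.of_cons (by simpa [boxedAnt] using hB)) hA (hσ _ _ _ _ hy)
        (hσ _ _ _ _ hz)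
  | impL => exact hl.elim
  | impR => exact hl.elim
  | cut => exact hl.elim

theorem Derives.permute_reduceBox
    (hρ : ∀ a c t t', ρ a c t t' → κ a c t t') (hσ : ∀ a c t t', σ a c t t' → κ a c t t')
    (H : ∀ a Θ₀ Θ₁ Θ C x x' y y', a ∈ (Sequent.mk S Θ {C}).Ann → Θ₀ ≤ Θ → Θ₁ ≤ B ::ₘ Θ →
      ρ none ⟨S, Θ₀, {B}⟩ x x' → σ a ⟨S, Θ₁, {C}⟩ y y' →
      κ a ⟨S, Θ, {C}⟩ (.elim B {C} x y) (.elim B {C} x' y'))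
    (hp : Derives M ρ S Γ (Formula.box B ::ₘ Δ) p p')
    (hq : Derives M σ S (Formula.box B ::ₘ Γ) Δ q q') :
    Derives M κ S Γ Δ (p.permute (reduceBox B) q) (p'.permute (reduceBox B) q') := by
  refine hp.permute (by simp) hq fun {Γ Δ p p' q q'} hl hp hq => ?_
  cases hp with
  | ax h => exact .ax (h.of_cons_right (by simp))
  | @box _ _ A S₀ L P x x' hm hA hx =>
    by_cases hB : A = B
    · subst hB
      simp only [MainTree.reduceBox, if_true]
      exact hq.mapModal (B := A) (by simp [boxedAnt]) hm.le fun hl hax hle hq =>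
        hq.mergeBox hσ (fun a Θ₁ Θ C y y' ha h₀ h₁ hy => H _ _ _ _ _ _ _ _ _ ha h₀ h₁ hx hy)
          ⟨hm.sub, hle, hm.slim⟩ hl hax
    · simp only [MainTree.reduceBox, hB, if_false]
      exact .box hm (by simpa [hB] using hA) (hρ _ _ _ _ hx)
  | boxPlus hm hA hx hy =>
    exact .boxPlus hm (by simpa using hA) (hρ _ _ _ _ hx) (hρ _ _ _ _ hy)
  | impL => exact hl.elim
  | impR => exact hl.elim
  | cut => exact hl.elim

theorem Derives.permute_reduceBoxPlus
    (hρ : ∀ a c t t', ρ a c t t' → κ a c t t') (hσ : ∀ a c t t', σ a c t t' → κ a c t t')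
    (H : ∀ a Θ₀ Θ₁ Θ C x x' x₁ x₁' y y', a ∈ (Sequent.mk S Θ {C}).Ann → Θ₀ ≤ Θ →
      Θ₁ ≤ Formula.boxPlus B ::ₘ B ::ₘ Θ → ρ none ⟨S, Θ₀, {B}⟩ x x' →
      ρ (some B) ⟨S, Θ₀, {Formula.boxPlus B}⟩ x₁ x₁' → σ a ⟨S, Θ₁, {C}⟩ y y' →
      κ a ⟨S, Θ, {C}⟩ (elimTwo B x x₁ C y) (elimTwo B x' x₁' C y'))
    (hp : Derives M ρ S Γ (Formula.boxPlus B ::ₘ Δ) p p')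
    (hq : Derives M σ S (Formula.boxPlus B ::ₘ Γ) Δ q q') :
    Derives M κ S Γ Δ (p.permute (reduceBoxPlus B) q) (p'.permute (reduceBoxPlus B) q') := by
  refine hp.permute (by simp) hq fun {Γ Δ p p' q q'} hl hp hq => ?_
  cases hp with
  | ax h => exact .ax (h.of_cons_right (by simp))
  | @boxPlus _ _ A S₀ L P x x' x₁ x₁' hm hA hx hx₁ =>
    by_cases hB : A = B
    · subst hB
      simp only [MainTree.reduceBoxPlus, if_true]
      exact hq.mapModal (B := A) (by simp [boxedAnt]) hm.le fun hl hax hle hq =>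
        hq.mergeBoxPlus hσ
          (fun a Θ₁ Θ C y y' ha h₀ h₁ hy => H _ _ _ _ _ _ _ _ _ _ _ ha h₀ h₁ hx hx₁ hy)
          ⟨hm.sub, hle, hm.slim⟩ hl hax
    · simp only [MainTree.reduceBoxPlus, hB, if_false]
      exact .boxPlus hm (by simpa [hB] using hA) (hρ _ _ _ _ hx) (hρ _ _ _ _ hx₁)
  | box hm hA hx => exact .box hm (by simpa using hA) (hρ _ _ _ _ hx)
  | impL => exact hl.elim
  | impR => exact hl.elim
  | cut => exact hl.elim

end Reduce

/-- The finite tree at the root of the tree represented by a term, where the value for leaves is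
given by `out`. -/
noncomputable def CutTerm.head (out : SeqTree → MainTree CutTerm) : CutTerm → MainTree CutTerm
  | .leaf t => out t
  | .elim A Δ t u => MainTree.elimCut A Δ (t.head out) (u.head out)

/-! ### The nested fixed point and elimination of cuts -/

section Fragments

/-- Relations between trees represented by terms that derive a given sequent. -/
abbrev TermRel : Type := Sequent → CutTerm → CutTerm → Prop

/-- The relation for the premises of a modal inference in a tree annotated with `s`: `Y` is used for
the right premise of `□⁺` that retains the annotation, and `X` is used otherwise. -/
def layer (X Y : TermRel) (s a : Annot) : TermRel :=
  fun c t t' => if a ≠ none ∧ a = s then Y c t t' else X c t t'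

variable (out : SeqTree → MainTree CutTerm) (M : Mode)

/-- The `i`-fragments of the trees annotated with `s` coincide up to the relation `X` between
subtrees whose roots are not equivalent to the root. -/
def Frag (X : TermRel) (s : Annot) : ℕ → TermRel
  | 0 => fun _ _ _ => True
  | i + 1 => fun c t t' =>
    Derives M (layer X (Frag X s i) s) c.ctx c.ant c.suc (t.head out) (t'.head out)

/-- The trees represented by the terms coincide and are `∞`-proofs of the given sequent. -/
def Good : TermRel := fun c t t' =>
  ∀ X : TermRel, (∀ c t t' s, (∀ i, Frag out M X s i c t t') → X c t t') → X c t t'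

variable {out M} {X Y : TermRel} {s : Annot} {i : ℕ} {c : Sequent} {S : Set Formula}
  {Γ Γ' Δ Δ' : Multiset Formula} {t t' u u' : CutTerm} {B : Formula}

theorem layer_mono {X' Y' : TermRel} {a : Annot} (hX : ∀ c t t', X c t t' → X' c t t')
    (hY : ∀ c t t', Y c t t' → Y' c t t') (h : layer X Y s a c t t') : layer X' Y' s a c t t' := by
  unfold layer at *
  split_ifs at * with ha
  · exact hY _ _ _ h
  · exact hX _ _ _ h

theorem layer_none_right {a : Annot} : layer X Y none a c t t' ↔ X c t t' := by
  unfold layer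
  rw [if_neg]
  rintro ⟨h₁, h₂⟩
  exact h₁ h₂

theorem layer_none_left : layer X Y s none c t t' ↔ X c t t' := by
  unfold layer
  rw [if_neg]
  rintro ⟨h₁, -⟩
  exact h₁ rfl

theorem Frag.mono (hX : ∀ c t t', X c t t' → Y c t t') (h : Frag out M X s i c t t') :
    Frag out M Y s i c t t' := by
  induction i generalizing c t t' with
  | zero => trivial
  | succ i ih => exact Derives.mono h fun a c x x' hx => layer_mono hX (fun _ _ _ => ih) hx

/-- Closure of the impredicatively defined least fixed point, by monotonicity of `Frag`. The
annotation can be chosen freely, as at a change of annotation on a branch. -/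
theorem Good.mk (s : Annot) (h : ∀ i, Frag out M (Good out M) s i c t t') : Good out M c t t' :=
  fun _ hX => hX _ _ _ s fun i => (h i).mono fun _ _ _ hg => hg _ hX

/-- Fixed-point induction, strengthened so that subtrees outside the class of the root are known to
be good as well as to satisfy X. -/
theorem Good.induction (hX : ∀ c t t' s,
      (∀ i, Frag out M (fun c t t' => Good out M c t t' ∧ X c t t') s i c t t') → X c t t')
    (h : Good out M c t t') : X c t t' :=
  (h (fun c t t' => Good out M c t t' ∧ X c t t') fun _ _ _ s hs =>
    ⟨Good.mk s fun i => (hs i).mono fun _ _ _ h => h.1, hX _ _ _ _ hs⟩).2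

theorem Good.exists_frag (h : Good out M c t t') : ∃ s, ∀ i, Frag out M (Good out M) s i c t t' :=
  Good.induction (X := fun c t t' => ∃ s, ∀ i, Frag out M (Good out M) s i c t t')
    (fun _ _ _ s hs => ⟨s, fun i => (hs i).mono fun _ _ _ h => h.1⟩) h

/-- One unfolding of the fixed point. A right premise that retains s satisfies all approximations,
collected by `Derives.forall_nat`, and is good with the same witness s. -/
theorem Good.derives (h : Good out M c t t') :
    Derives M (fun _ => Good out M) c.ctx c.ant c.suc (t.head out) (t'.head out) := by
  obtain ⟨s, hs⟩ := h.exists_frag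
  refine (Derives.forall_nat fun i => hs (i + 1)).mono fun a c x x' hx => ?_
  by_cases ha : a ≠ none ∧ a = s
  · refine Good.mk s fun i => ?_
    simpa only [layer, if_pos ha] using hx i
  · simpa only [layer, if_neg ha] using hx 0

/-- Goodness controls the whole tree, so it gives every fragment for every annotation, not only for
the witnessing one. -/
theorem Good.frag (h : Good out M c t t') : Frag out M (Good out M) s i c t t' := by
  induction i generalizing c t t' with
  | zero => trivial
  | succ i ih =>
    refine h.derives.mono fun a c x x' hx => ?_
    unfold layer
    split_ifs
    · exact ih hx
    · exact hx

/-- No right premise of □⁺ retains the annotation ∘, so one layer with good premises already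
contains all approximations. -/
theorem Good.of_frag_none (h : Frag out M (Good out M) none (i + 1) c t t') : Good out M c t t' := by
  refine Good.mk none fun j => ?_
  cases j with
  | zero => trivial
  | succ j => exact Derives.mono h fun a c x x' hx => layer_none_right.2 (layer_none_right.1 hx)

theorem Frag.weaken (h : Frag out M X s i ⟨S, Γ, Δ⟩ t t') (hΓ : Γ ≤ Γ') (hΔ : Δ ≤ Δ') :
    Frag out M X s i ⟨S, Γ', Δ'⟩ t t' := by
  cases i with
  | zero => trivial
  | succ i => exact Derives.weaken h hΓ hΔ

theorem Good.weaken (h : Good out M ⟨S, Γ, Δ⟩ t t') (hΓ : Γ ≤ Γ') (hΔ : Δ ≤ Δ') :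
    Good out M ⟨S, Γ', Δ'⟩ t t' :=
  Good.of_frag_none (i := 0) (h.frag.weaken hΓ hΔ)

/-- Elimination of cuts with the cut formula `B` respects the fragments. -/
def CutEliminable (out : SeqTree → MainTree CutTerm) (M : Mode) (B : Formula) : Prop :=
  ∀ (s : Annot) (i : ℕ) (S : Set Formula) (Γ Δ : Multiset Formula), s ∈ (Sequent.mk S Γ Δ).Ann →
    ∀ p p' q q' : MainTree CutTerm,
      Derives M (layer (Good out M) (Frag out M (Good out M) s i) s) S Γ (B ::ₘ Δ) p p' →
      Derives M (layer (Good out M) (Frag out M (Good out M) s i) s) S (B ::ₘ Γ) Δ q q' →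
      Derives M (layer (Good out M) (Frag out M (Good out M) s i) s) S Γ Δ
        (MainTree.elimCut B Δ p q) (MainTree.elimCut B Δ p' q')

theorem CutEliminable.frag (hB : CutEliminable out M B) (hs : s ∈ (Sequent.mk S Γ Δ).Ann)
    (ht : Frag out M (Good out M) s i ⟨S, Γ, B ::ₘ Δ⟩ t t')
    (hu : Frag out M (Good out M) s i ⟨S, B ::ₘ Γ, Δ⟩ u u') :
    Frag out M (Good out M) s i ⟨S, Γ, Δ⟩ (.elim B Δ t u) (.elim B Δ t' u') := by
  cases i with
  | zero => trivial
  | succ i => exact hB s i S Γ Δ hs _ _ _ _ ht hu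

theorem CutEliminable.good (hB : CutEliminable out M B)
    (ht : Good out M ⟨S, Γ, B ::ₘ Δ⟩ t t') (hu : Good out M ⟨S, B ::ₘ Γ, Δ⟩ u u') :
    Good out M ⟨S, Γ, Δ⟩ (.elim B Δ t u) (.elim B Δ t' u') :=
  Good.of_frag_none (i := 0) (hB.frag (none_mem_Ann _) ht.frag hu.frag)

/-- The left premise of a pending cut on B comes from a premise annotated with ∘ and is fully good;
only the right one depends on whether the annotation is retained. -/
theorem CutEliminable.layer_elim {a : Annot} (hB : CutEliminable out M B)
    (ha : a ∈ (Sequent.mk S Γ Δ).Ann) (ht : Good out M ⟨S, Γ, B ::ₘ Δ⟩ t t')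
    (hu : layer (Good out M) (Frag out M (Good out M) s i) s a ⟨S, B ::ₘ Γ, Δ⟩ u u') :
    layer (Good out M) (Frag out M (Good out M) s i) s a ⟨S, Γ, Δ⟩
      (.elim B Δ t u) (.elim B Δ t' u') := by
  unfold layer at *
  split_ifs at * with has
  · exact hB.frag (has.2 ▸ ha) ht.frag hu
  · exact hB.good ht hu

theorem layer_weaken {a : Annot}
    (h : layer (Good out M) (Frag out M (Good out M) s i) s a ⟨S, Γ, Δ⟩ t t')
    (hΓ : Γ ≤ Γ') (hΔ : Δ ≤ Δ') :
    layer (Good out M) (Frag out M (Good out M) s i) s a ⟨S, Γ', Δ'⟩ t t' := by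
  unfold layer at *
  split_ifs at *
  · exact h.weaken hΓ hΔ
  · exact h.weaken hΓ hΔ

theorem cutEliminable_var (n : ℕ) : CutEliminable out M (.var n) :=
  fun _ _ _ _ _ _ _ _ _ _ hp hq => hp.permute (by simp) hq fun hl hp hq => hp.reduceVar hl hq

theorem cutEliminable_bot : CutEliminable out M .bot :=
  fun _ _ _ _ _ _ _ _ _ _ hp _ => hp.erase_right (Or.inl rfl)

theorem CutEliminable.imp {A : Formula} (hA : CutEliminable out M A) (hB : CutEliminable out M B) :
    CutEliminable out M (.imp A B) := by
  intro s i S Γ Δ hs p p' q q' hp hq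
  refine hB s i S Γ Δ hs _ _ _ _ (hA s i S Γ (B ::ₘ Δ) ?_ _ _ _ _ ?_ hp.invR) hq.invLL
  · exact fun C hC => Multiset.mem_cons_of_mem (hs C hC)
  · exact hq.invLR.weaken le_rfl (Multiset.cons_le_cons _ (Multiset.le_cons_self _ _))

theorem CutEliminable.box (hB : CutEliminable out M B) : CutEliminable out M (.box B) := by
  intro s i S Γ Δ hs p p' q q' hp hq
  refine hp.permute_reduceBox (fun _ _ _ _ h => h) (fun _ _ _ _ h => h) ?_ hq
  intro a Θ₀ Θ₁ Θ C x x' y y' ha h₀ h₁ hx hy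
  rw [layer_none_left] at hx
  exact hB.layer_elim ha (hx.weaken h₀ (by simp)) (layer_weaken hy h₁ le_rfl)

/-- The pending □⁺B-cut in a merged inference has a premise y of the right tree as its right
premise. If y leaves the class of the root, the fixed-point hypothesis applies; otherwise the
induction on i does. The left premise and the context change along the way and are therefore
arbitrary; cuts on B are covered by `hB`. -/
theorem CutEliminable.good_boxPlus (hB : CutEliminable out M B)
    (hu : Good out M c u u') :
    ∀ Γ Δ t t', c.ant ≤ Formula.boxPlus B ::ₘ Γ → c.suc ≤ Δ →
      Good out M ⟨c.ctx, Γ, Formula.boxPlus B ::ₘ Δ⟩ t t' →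
      Good out M ⟨c.ctx, Γ, Δ⟩ (.elim (.boxPlus B) Δ t u) (.elim (.boxPlus B) Δ t' u') := by
  refine Good.induction (X := fun c u u' => ∀ Γ Δ t t', c.ant ≤ Formula.boxPlus B ::ₘ Γ →
    c.suc ≤ Δ → Good out M ⟨c.ctx, Γ, Formula.boxPlus B ::ₘ Δ⟩ t t' →
      Good out M ⟨c.ctx, Γ, Δ⟩ (.elim (.boxPlus B) Δ t u) (.elim (.boxPlus B) Δ t' u')) ?_ hu
  clear hu
  intro c u u' s hu Γ Δ t t' hΓ hΔ ht
  -- The result is annotated with the formula that witnesses the goodness of the right premise, so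
  -- both descend through levels together.
  refine Good.mk s fun i => ?_
  replace hu := hu i
  induction i generalizing c u u' Γ Δ t t' with
  | zero => trivial
  | succ i ih =>
    change Derives M _ _ _ _ (MainTree.elimCut _ _ _ _) (MainTree.elimCut _ _ _ _)
    by_cases hf : Formula.boxPlus B ∈ Δ
    · simp only [MainTree.elimCut, hf, if_true]
      exact Derives.erase_right (ht.frag (s := s) (i := i + 1)) (Or.inr ⟨by simp, hf⟩)
    · simp only [MainTree.elimCut, hf, if_false]
      refine Derives.permute_reduceBoxPlus (ρ := fun _ => Good out M) ?_ ?_ ?_ ht.derives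
        (Derives.weaken hu hΓ hΔ)
      · intro a c x x' hx
        unfold layer
        split_ifs
        · exact hx.frag
        · exact hx
      · exact fun a c x x' hx => layer_mono (fun _ _ _ h => h.1)
          (fun _ _ _ h => h.mono fun _ _ _ h => h.1) hx
      · intro a Θ₀ Θ₁ Θ C x x' x₁ x₁' y y' ha h₀ h₁ hx hx₁ hy
        refine hB.layer_elim ha (hx.weaken h₀ (by simp)) ?_
        have hx₁' := hx₁.weaken (h₀.trans (Multiset.le_cons_self _ B))
          (show {Formula.boxPlus B} ≤ Formula.boxPlus B ::ₘ {C} by simp)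
        unfold layer at *
        split_ifs at * with has
        · exact ih ⟨_, Θ₁, {C}⟩ y y' _ _ _ _ h₁ le_rfl hx₁' hy
        · exact hy.2 _ _ _ _ h₁ le_rfl hx₁'

/-- Induction on the level. If □⁺B is not in Δ, the annotation s differs from B, so the right
premise `x₁` of the left-hand □⁺ is good and does not use up a level. A premise of the right tree
that retains s is treated by induction, and any other is good and falls under
`CutEliminable.good_boxPlus`. -/
theorem CutEliminable.boxPlus (hB : CutEliminable out M B) : CutEliminable out M (.boxPlus B) := by
  intro s i
  induction i with
  | zero => ?_
  | succ i ih => ?_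
  all_goals
    intro S Γ Δ hs p p' q q' hp hq
    by_cases hf : Formula.boxPlus B ∈ Δ
    · simp only [MainTree.elimCut, hf, if_true]
      exact Derives.erase_right hp (Or.inr ⟨by simp, hf⟩)
    simp only [MainTree.elimCut, hf, if_false]
    refine hp.permute_reduceBoxPlus (fun _ _ _ _ h => h) (fun _ _ _ _ h => h) ?_ hq
    intro a Θ₀ Θ₁ Θ C x x' x₁ x₁' y y' ha h₀ h₁ hx hx₁ hy
    have hsB : ¬ ((some B : Annot) ≠ none ∧ some B = s) := by
      rintro ⟨-, rfl⟩
      exact hf (hs B rfl)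
    rw [layer_none_left] at hx
    simp only [layer, if_neg hsB] at hx₁
    refine hB.layer_elim ha (hx.weaken h₀ (by simp)) ?_
    have hx₁' := hx₁.weaken (h₀.trans (Multiset.le_cons_self _ B))
      (show {Formula.boxPlus B} ≤ Formula.boxPlus B ::ₘ {C} by simp)
    unfold layer at *
    split_ifs at * with has
  -- The first two goals belong to level 0, the last two to the successor; in each pair the
  -- annotation is first retained, then left. At level 0 a retained premise lies outside the
  -- fragment.
  · trivial
  · exact hB.good_boxPlus hy _ _ _ _ h₁ le_rfl hx₁'
  · exact ih S _ _ (has.2 ▸ fun D hD => ha D hD) _ _ _ _ (Good.frag (i := i + 1) hx₁')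
      (Frag.weaken (i := i + 1) hy h₁ le_rfl)
  · exact hB.good_boxPlus hy _ _ _ _ h₁ le_rfl hx₁'

theorem cutEliminable (A : Formula) : CutEliminable out M A := by
  induction A with
  | var n => exact cutEliminable_var n
  | bot => exact cutEliminable_bot
  | imp A B hA hB => exact hA.imp hB
  | box B hB => exact hB.box
  | boxPlus B hB => exact hB.boxPlus

end Fragments

/-! ### Infinite paths and immediate subtrees -/

section Paths

theorem pathPrefix_zero (f : ℕ → Bool) : pathPrefix f 0 = [] := rfl

theorem pathPrefix_succ (f : ℕ → Bool) (n : ℕ) : pathPrefix f (n + 1) = pathPrefix f n ++ [f n] := by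
  simp [pathPrefix, List.range_succ]

theorem pathPrefix_succ' (f : ℕ → Bool) (n : ℕ) :
    pathPrefix f (n + 1) = f 0 :: pathPrefix (fun k => f (k + 1)) n := by
  simp [pathPrefix, List.range_succ_eq_map, Function.comp_def]

/-- The subtree at an immediate successor of the root. -/
def SeqTree.sub (t : SeqTree) (b : Bool) : SeqTree := fun w => t (b :: w)

theorem goodTail_succ_iff {t : SeqTree} {f : ℕ → Bool} {N : ℕ} {A : Formula} :
    GoodTail t f (N + 1) A ↔ GoodTail (t.sub (f 0)) (fun k => f (k + 1)) N A := by
  have key : ∀ n, (t.sub (f 0)).ruleAt (pathPrefix (fun k => f (k + 1)) n) =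
      t.ruleAt (pathPrefix f (n + 1)) := fun n => by rw [pathPrefix_succ']; rfl
  simp only [GoodTail, key]
  constructor
  · rintro ⟨h₁, h₂, h₃, h₄⟩
    refine ⟨fun n hn => h₁ _ (by omega), fun m => ?_, fun n hn => h₃ _ (by omega),
      fun n hn => h₄ _ (by omega)⟩
    obtain ⟨n, hn, h⟩ := h₂ (m + 1)
    obtain ⟨n, rfl⟩ : ∃ k, n = k + 1 := ⟨n - 1, by omega⟩
    exact ⟨n, by omega, h⟩
  · rintro ⟨h₁, h₂, h₃, h₄⟩
    have shift : ∀ n, n ≥ N + 1 → ∃ k ≥ N, n = k + 1 := fun n hn => ⟨n - 1, by omega, by omega⟩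
    refine ⟨fun n hn => ?_, fun m => ?_, fun n hn => ?_, fun n hn => ?_⟩
    · obtain ⟨k, hk, rfl⟩ := shift n hn
      exact h₁ k hk
    · obtain ⟨n, hn, h⟩ := h₂ m
      exact ⟨n + 1, by omega, h⟩
    · obtain ⟨k, hk, rfl⟩ := shift n hn
      exact h₃ k hk
    · obtain ⟨k, hk, rfl⟩ := shift n hn
      exact h₄ k hk

theorem GoodTail.mono {t : SeqTree} {f : ℕ → Bool} {N N' : ℕ} {A : Formula}
    (h : GoodTail t f N A) (hN : N ≤ N') : GoodTail t f N' A :=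
  ⟨fun n hn => h.1 n (hN.trans hn), h.2.1, fun n hn => h.2.2.1 n (hN.trans hn),
    fun n hn => h.2.2.2 n (hN.trans hn)⟩

/-- Iteration of a step from a tree to one of its immediate subtrees. -/
theorem exists_path {St : Type*} (tree : St → SeqTree) (R : St → Bool → St → Prop)
    (h : ∀ σ, ∃ b σ', tree σ' = (tree σ).sub b ∧ R σ b σ') (σ₀ : St) :
    ∃ (f : ℕ → Bool) (σ : ℕ → St), σ 0 = σ₀ ∧ (∀ n, R (σ n) (f n) (σ (n + 1))) ∧
      ∀ n w, tree (σ n) w = tree σ₀ (pathPrefix f n ++ w) := by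
  choose g next hg hR using h
  let σ : ℕ → St := fun n => Nat.rec σ₀ (fun _ τ => next τ) n
  refine ⟨fun n => g (σ n), σ, rfl, fun n => hR (σ n), fun n => ?_⟩
  induction n with
  | zero => intro w; rfl
  | succ n ih =>
    intro w
    rw [pathPrefix_succ, List.append_assoc, List.singleton_append, ← ih]
    exact congrFun (hg (σ n)) w

end Paths

/-! ### From ∞-proofs to good terms -/

namespace SeqTree

/-- The tree underlies an `∞`-proof. -/
structure IsProof (t : SeqTree) : Prop where
  root_mem : (t []).isSome
  closed : ∀ w b, t w = none → t (w ++ [b]) = none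
  step : ∀ w c r, t w = some (c, r) →
    ∃ ps : List Sequent, Inference c r ps ∧ ∀ b : Bool, t.seqAt (w ++ [b]) = ps[b.toNat]?
  branch : ∀ f : ℕ → Bool, (∀ n, (t (pathPrefix f n)).isSome) → ∃ N A, GoodTail t f N A

variable {t t' : SeqTree} {c d : Sequent} {r : Rule} {M : Mode} {s : Annot} {i : ℕ}

theorem IsProof.of_infProof (π : InfProof) : IsProof π.tree :=
  ⟨π.root_mem, π.closed, π.step, π.branch⟩

theorem IsProof.sub {b : Bool} (h : t.IsProof) (hb : t.seqAt [b] = some d) :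
    (t.sub b).IsProof where
  root_mem := by
    obtain ⟨x, hx, -⟩ := Option.map_eq_some_iff.1 hb
    exact Option.isSome_iff_exists.2 ⟨x, hx⟩
  closed w := h.closed (b :: w)
  step w := h.step (b :: w)
  branch f hf := by
    let f' : ℕ → Bool := fun n => Nat.casesOn n b f
    obtain ⟨N, A, hN⟩ := h.branch f' fun n => by
      cases n with
      | zero => exact h.root_mem
      | succ n => rw [pathPrefix_succ']; exact hf n
    -- The tail is started one step later, so that it avoids the root before the shift.
    exact ⟨N, A, goodTail_succ_iff.1 (hN.mono (Nat.le_succ N))⟩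

/-- The possibilities for the inference at the root. -/
inductive RootStep (t : SeqTree) (c : Sequent) : Rule → Prop
  | ax (h : Initial c.ant c.suc) : RootStep t c .ax
  | impL {A B Γ₀} (e : c.ant = Formula.imp A B ::ₘ Γ₀)
      (hl : t.seqAt [false] = some ⟨c.ctx, B ::ₘ Γ₀, c.suc⟩)
      (hr : t.seqAt [true] = some ⟨c.ctx, Γ₀, A ::ₘ c.suc⟩) : RootStep t c (.impL A B)
  | impR {A B Δ₀} (e : c.suc = Formula.imp A B ::ₘ Δ₀)
      (hl : t.seqAt [false] = some ⟨c.ctx, A ::ₘ c.ant, B ::ₘ Δ₀⟩) : RootStep t c (.impR A B)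
  | cut {A} (hl : t.seqAt [false] = some ⟨c.ctx, c.ant, A ::ₘ c.suc⟩)
      (hr : t.seqAt [true] = some ⟨c.ctx, A ::ₘ c.ant, c.suc⟩) : RootStep t c (.cut A)
  | box {A Θ} (h : ∃ L P, ModalStep c.ctx c.ant Θ L P) (hA : Formula.box A ∈ c.suc)
      (hl : t.seqAt [false] = some ⟨c.ctx, Θ, {A}⟩) : RootStep t c (.box A)
  | boxPlus {A Θ} (h : ∃ L P, ModalStep c.ctx c.ant Θ L P) (hA : Formula.boxPlus A ∈ c.suc)
      (hl : t.seqAt [false] = some ⟨c.ctx, Θ, {A}⟩)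
      (hr : t.seqAt [true] = some ⟨c.ctx, Θ, {Formula.boxPlus A}⟩) : RootStep t c (.boxPlus A)

theorem IsProof.rootStep (h : t.IsProof) (hc : t [] = some (c, r)) : RootStep t c r := by
  obtain ⟨ps, hps, hb⟩ := h.step [] c r hc
  have hf := hb false
  have ht := hb true
  simp only [List.nil_append, Bool.toNat_false, Bool.toNat_true] at hf ht
  cases hps with
  | axVar S Γ Δ p => exact .ax (Or.inr ⟨p, by simp, by simp⟩)
  | axBot S Γ Δ => exact .ax (Or.inl (by simp))
  | impL S Γ Δ A B => exact .impL rfl hf ht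
  | impR S Γ Δ A B => exact .impR rfl hf
  | box S Γ Θ L P Ψ A hm => exact .box ⟨L, P, hm⟩ (by simp) hf
  | boxPlus S Γ Θ L P Ψ A hm => exact .boxPlus ⟨L, P, hm⟩ (by simp) hf ht
  | cut S Γ Δ A => exact .cut hf ht

theorem exists_modalOK {L P : Multiset Formula} {Θ : Multiset Formula}
    (h : ModalStep c.ctx c.ant Θ L P) (hs : M.slim → L.Nodup ∧ P.Nodup) :
    ∃ S₀ : Finset Formula, ModalOK M c.ctx c.ant S₀ L P ∧ Θ = premAnt S₀ L P := by
  obtain ⟨Φ, S₀, h₁, h₂, h₃⟩ := h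
  refine ⟨S₀, ⟨h₁, ?_, hs⟩, h₃⟩
  rw [h₂, add_assoc]
  exact Multiset.le_add_left _ _

open Classical in
/-- The data of a modal inference with the conclusion `c` and the (left) premise `d`. -/
noncomputable def modalData (c d : Sequent) :
    Finset Formula × Multiset Formula × Multiset Formula :=
  if h : ∃ x : Finset Formula × Multiset Formula × Multiset Formula,
      -- Slim data are preferred, so one choice serves both values of `slim`. The component `noCut`
      -- is irrelevant to `ModalOK`.
      ModalOK ⟨True, True⟩ c.ctx c.ant x.1 x.2.1 x.2.2 ∧ d.ant = premAnt x.1 x.2.1 x.2.2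
  then h.choose
  else if h : ∃ x : Finset Formula × Multiset Formula × Multiset Formula,
      ModalOK ⟨True, False⟩ c.ctx c.ant x.1 x.2.1 x.2.2 ∧ d.ant = premAnt x.1 x.2.1 x.2.2
  then h.choose
  else (∅, 0, 0)

theorem modalData_spec (h : ∃ L P, ModalStep c.ctx c.ant d.ant L P)
    (hs : M.slim → ∃ L P : Multiset Formula, L.Nodup ∧ P.Nodup ∧
      ModalStep c.ctx c.ant d.ant L P) :
    ModalOK M c.ctx c.ant (modalData c d).1 (modalData c d).2.1 (modalData c d).2.2 ∧
      d.ant = premAnt (modalData c d).1 (modalData c d).2.1 (modalData c d).2.2 := by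
  unfold modalData
  split_ifs with h₁ h₂
  · have := h₁.choose_spec
    exact ⟨⟨this.1.sub, this.1.le, fun _ => this.1.slim trivial⟩, this.2⟩
  · have := h₂.choose_spec
    refine ⟨⟨this.1.sub, this.1.le, fun hM => absurd ?_ h₁⟩, this.2⟩
    obtain ⟨L, P, hL, hP, hm⟩ := hs hM
    obtain ⟨S₀, hS₀⟩ := exists_modalOK (M := ⟨True, True⟩) hm fun _ => ⟨hL, hP⟩
    exact ⟨⟨S₀, L, P⟩, hS₀⟩
  · obtain ⟨L, P, hm⟩ := h
    obtain ⟨S₀, hS₀⟩ := exists_modalOK (M := ⟨True, False⟩) hm False.elim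
    exact absurd ⟨⟨S₀, L, P⟩, hS₀⟩ h₂

/-- `m` represents the part of `t` up to the modal inferences that are the nearest to the root. -/
inductive Represents : SeqTree → MainTree CutTerm → Prop
  | ax {t : SeqTree} {c : Sequent} (h : t [] = some (c, .ax)) : Represents t .ax
  | impL {t : SeqTree} {c : Sequent} {A B l r} (h : t [] = some (c, .impL A B))
      (hl : Represents (t.sub false) l) (hr : Represents (t.sub true) r) : Represents t (.impL A B l r)
  | impR {t : SeqTree} {c : Sequent} {A B l} (h : t [] = some (c, .impR A B))
      (hl : Represents (t.sub false) l) :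
      Represents t (.impR A B l)
  | cut {t : SeqTree} {c : Sequent} {A l r} (h : t [] = some (c, .cut A))
      (hl : Represents (t.sub false) l) (hr : Represents (t.sub true) r) : Represents t (.cut A l r)
  | box {t : SeqTree} {c d : Sequent} {A : Formula} (h : t [] = some (c, .box A))
      (hd : t.seqAt [false] = some d) :
      Represents t (.box A (modalData c d).1 (modalData c d).2.1 (modalData c d).2.2
        (.leaf (t.sub false)))
  | boxPlus {t : SeqTree} {c d : Sequent} {A : Formula} (h : t [] = some (c, .boxPlus A))
      (hd : t.seqAt [false] = some d) :
      Represents t (.boxPlus A (modalData c d).1 (modalData c d).2.1 (modalData c d).2.2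
        (.leaf (t.sub false)) (.leaf (t.sub true)))

/-- The data of a modal leaf are a function of the conclusion and the left premise alone. For this
reason trees with equal fragments also get equal data. -/
theorem Represents.unique {m m' : MainTree CutTerm} (h : Represents t m) (h' : Represents t m') :
    m = m' := by
  induction h generalizing m' with
  | ax h => cases h' <;> simp_all
  | impL h _ _ ihl ihr =>
    cases h' with
    | impL h' hl hr =>
      rw [h] at h'; cases h'
      rw [ihl hl, ihr hr]
    | _ => simp_all
  | impR h _ ihl =>
    cases h' with
    | impR h' hl =>
      rw [h] at h'; cases h'
      rw [ihl hl]
    | _ => simp_all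
  | cut h _ _ ihl ihr =>
    cases h' with
    | cut h' hl hr =>
      rw [h] at h'; cases h'
      rw [ihl hl, ihr hr]
    | _ => simp_all
  | box h hd =>
    cases h' with
    | box h' hd' =>
      rw [h] at h'; cases h'
      rw [hd] at hd'; cases hd'
      rfl
    | _ => simp_all
  | boxPlus h hd =>
    cases h' with
    | boxPlus h' hd' =>
      rw [h] at h'; cases h'
      rw [hd] at hd'; cases hd'
      rfl
    | _ => simp_all

open Classical in
/-- The part of a tree up to the modal inferences that are the nearest to the root. -/
noncomputable def mainTree (t : SeqTree) : MainTree CutTerm :=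
  if h : ∃ m, Represents t m then h.choose else .ax

theorem Represents.mainTree_eq {m : MainTree CutTerm} (h : Represents t m) : t.mainTree = m := by
  have h' : ∃ m, Represents t m := ⟨m, h⟩
  rw [mainTree, dif_pos h']
  exact h'.choose_spec.unique h

/-- Without a finite main tree there would be an infinite branch through non-modal inferences only,
contrary to condition (b). -/
theorem IsProof.represents (h : t.IsProof) : Represents t t.mainTree := by
  suffices H : ∃ m, Represents t m by
    obtain ⟨m, hm⟩ := H
    rwa [hm.mainTree_eq]
  by_contra hn
  let St := {u : SeqTree // u.IsProof ∧ ¬ ∃ m, Represents u m}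
  obtain ⟨f, σ, h₀, hR, hσ⟩ := exists_path (St := St) (fun u => u.1)
    (fun u _ _ => ∀ A, u.1.ruleAt [] ≠ some (.boxPlus A)) (by
      rintro ⟨u, hu, hun⟩
      obtain ⟨⟨c, r⟩, hc⟩ := Option.isSome_iff_exists.1 hu.root_mem
      have hr : u.ruleAt [] = some r := by simp [ruleAt, hc]
      cases hu.rootStep hc with
      | ax h => exact absurd ⟨_, .ax hc⟩ hun
      | impL e hl hr' =>
        by_cases h₁ : ∃ m, Represents (u.sub false) m
        · by_cases h₂ : ∃ m, Represents (u.sub true) m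
          · exact absurd ⟨_, .impL hc h₁.choose_spec h₂.choose_spec⟩ hun
          · exact ⟨true, ⟨_, hu.sub hr', h₂⟩, rfl, by simp [hr]⟩
        · exact ⟨false, ⟨_, hu.sub hl, h₁⟩, rfl, by simp [hr]⟩
      | impR e hl =>
        by_cases h₁ : ∃ m, Represents (u.sub false) m
        · exact absurd ⟨_, .impR hc h₁.choose_spec⟩ hun
        · exact ⟨false, ⟨_, hu.sub hl, h₁⟩, rfl, by simp [hr]⟩
      | cut hl hr' =>
        by_cases h₁ : ∃ m, Represents (u.sub false) m
        · by_cases h₂ : ∃ m, Represents (u.sub true) m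
          · exact absurd ⟨_, .cut hc h₁.choose_spec h₂.choose_spec⟩ hun
          · exact ⟨true, ⟨_, hu.sub hr', h₂⟩, rfl, by simp [hr]⟩
        · exact ⟨false, ⟨_, hu.sub hl, h₁⟩, rfl, by simp [hr]⟩
      | box h hA hl => exact absurd ⟨_, .box hc hl⟩ hun
      | boxPlus h hA hl hr => exact absurd ⟨_, .boxPlus hc hl⟩ hun) ⟨t, h, hn⟩
  have hσ' : ∀ n, (σ n).1 [] = t (pathPrefix f n) := fun n => by simpa using hσ n []
  obtain ⟨N, A, -, hb, -⟩ := h.branch f fun n => hσ' n ▸ (σ n).2.1.root_mem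
  obtain ⟨n, -, B, hB, -⟩ := hb 0
  exact hR n B (by rw [← hB]; simp [ruleAt, hσ'])

/-- The inference at the node `w` is allowed by `M`. -/
def Allowed (M : Mode) (t : SeqTree) (w : List Bool) : Prop :=
  (M.noCut → ∀ A, t.ruleAt w ≠ some (.cut A)) ∧ (M.slim → SlimAt t w)

theorem Allowed.modalData_spec {Θ Δ : Multiset Formula} (h : t.Allowed M [])
    (hc : t [] = some (c, r)) (hr : r.IsModal) (hm : ∃ L P, ModalStep c.ctx c.ant Θ L P)
    (hd : t.seqAt [false] = some ⟨c.ctx, Θ, Δ⟩) (e : d = ⟨c.ctx, Θ, Δ⟩) :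
    ModalOK M c.ctx c.ant (modalData c d).1 (modalData c d).2.1 (modalData c d).2.2 ∧
      Θ = premAnt (modalData c d).1 (modalData c d).2.1 (modalData c d).2.2 := by
  subst e
  exact SeqTree.modalData_spec (d := ⟨c.ctx, Θ, Δ⟩) hm fun hM => h.2 hM c r _ hc hr hd

/-- The tree at a node of an infinite path that witnesses that a leaf is not good. -/
structure BadState (M : Mode) : Type where
  tree : SeqTree
  seq : Sequent
  ann : Annot
  idx : ℕ
  proof : tree.IsProof
  allowed : ∀ w, tree.Allowed M w
  root : tree.seqAt [] = some seq
  bad : ¬ Frag mainTree M (Good mainTree M) ann idx seq (.leaf tree) (.leaf tree)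

/-- The relation between successive states of a path that witnesses that a leaf is not good. -/
structure BadStep (σ : BadState M) (b : Bool) (σ' : BadState M) (r : Rule) : Prop where
  rule : σ.tree.ruleAt [] = some r
  ann : σ'.ann = r.next σ.ann b
  idx : ¬ r.IsModal → σ'.idx = σ.idx
  idx_boxPlus : ∀ A, r = .boxPlus A → b = true → σ.ann = some A → σ'.idx + 1 = σ.idx

/-- If all premises satisfied what `Derives` asks of them, the conclusion would too; hence some
premise fails. Within the class of the root the failing index drops by one at each □⁺; on leaving
the class a new index is chosen. -/
theorem BadState.exists_step (σ : BadState M) :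
    ∃ b σ', BadState.tree σ' = σ.tree.sub b ∧ ∃ r, BadStep σ b σ' r := by
  obtain ⟨t, c, s, i, ht, hM, hroot, hbad⟩ := σ
  obtain ⟨⟨c', r⟩, hc⟩ := Option.isSome_iff_exists.1 ht.root_mem
  obtain rfl : c' = c := by simpa [seqAt, hc] using hroot
  have hr : t.ruleAt [] = some r := by simp [ruleAt, hc]
  cases i with
  | zero => exact absurd trivial hbad
  | succ i =>
  have mk : ∀ (b : Bool) (d : Sequent) (s' : Annot) (i' : ℕ), t.seqAt [b] = some d →
      ¬ Frag mainTree M (Good mainTree M) s' i' d (.leaf (t.sub b)) (.leaf (t.sub b)) →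
      s' = r.next s b → (¬ r.IsModal → i' = i + 1) →
      (∀ A, r = .boxPlus A → b = true → s = some A → i' + 1 = i + 1) →
      ∃ b σ', BadState.tree σ' = t.sub b ∧
        ∃ r, BadStep ⟨t, c', s, i + 1, ht, hM, hroot, hbad⟩ b σ' r :=
    fun b d s' i' h₁ h₂ h₃ h₄ h₅ => ⟨b, ⟨t.sub b, d, s', i', ht.sub h₁, fun w => hM (b :: w), h₁, h₂⟩,
      rfl, r, hr, h₃, h₄, h₅⟩
  have hG : ∀ (b : Bool) (d : Sequent), t.seqAt [b] = some d →
      ¬ Good mainTree M d (.leaf (t.sub b)) (.leaf (t.sub b)) → r.IsModal →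
      (∀ A, r = .boxPlus A → b = true → s ≠ some A) →
      ∃ b σ', BadState.tree σ' = t.sub b ∧
        ∃ r, BadStep ⟨t, c', s, i + 1, ht, hM, hroot, hbad⟩ b σ' r := by
    intro b d hd hn hm hs
    -- A premise that is not good fails some approximation for its own annotation, by `Good.mk`. The
    -- index j found here is unrelated to the previous one.
    have : ¬ ∀ j, Frag mainTree M (Good mainTree M) (r.next s b) j d (.leaf (t.sub b))
        (.leaf (t.sub b)) := fun h => hn (Good.mk _ h)
    push Not at this
    obtain ⟨j, hj⟩ := this
    exact mk b d _ j hd hj rfl (fun h => absurd hm h) fun A h₁ h₂ h₃ => absurd h₃ (hs A h₁ h₂)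
  have hrep : ∀ {b d}, t.seqAt [b] = some d → Represents (t.sub b) (t.sub b).mainTree :=
    fun h => (ht.sub h).represents
  change ¬ Derives M _ _ _ _ t.mainTree t.mainTree at hbad
  cases ht.rootStep hc with
  | ax h => exact absurd (by rw [Represents.mainTree_eq (.ax hc)]; exact .ax h) hbad
  | @impL A B Γ₀ e hl hr' =>
    by_cases h₁ : Frag mainTree M (Good mainTree M) s (i + 1) ⟨c'.ctx, B ::ₘ Γ₀, c'.suc⟩
      (.leaf (t.sub false)) (.leaf (t.sub false))
    · by_cases h₂ : Frag mainTree M (Good mainTree M) s (i + 1) ⟨c'.ctx, Γ₀, A ::ₘ c'.suc⟩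
        (.leaf (t.sub true)) (.leaf (t.sub true))
      · refine absurd ?_ hbad
        rw [Represents.mainTree_eq (.impL hc (hrep hl) (hrep hr'))]
        exact .impL e h₁ h₂
      · exact mk _ _ _ _ hr' h₂ rfl (fun _ => rfl) (by simp)
    · exact mk _ _ _ _ hl h₁ rfl (fun _ => rfl) (by simp)
  | @impR A B Δ₀ e hl =>
    by_cases h₁ : Frag mainTree M (Good mainTree M) s (i + 1) ⟨c'.ctx, A ::ₘ c'.ant, B ::ₘ Δ₀⟩
      (.leaf (t.sub false)) (.leaf (t.sub false))
    · refine absurd ?_ hbad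
      rw [Represents.mainTree_eq (.impR hc (hrep hl))]
      exact .impR e h₁
    · exact mk _ _ _ _ hl h₁ rfl (fun _ => rfl) (by simp)
  | @cut A hl hr' =>
    by_cases h₁ : Frag mainTree M (Good mainTree M) s (i + 1) ⟨c'.ctx, c'.ant, A ::ₘ c'.suc⟩
      (.leaf (t.sub false)) (.leaf (t.sub false))
    · by_cases h₂ : Frag mainTree M (Good mainTree M) s (i + 1) ⟨c'.ctx, A ::ₘ c'.ant, c'.suc⟩
        (.leaf (t.sub true)) (.leaf (t.sub true))
      · refine absurd ?_ hbad
        rw [Represents.mainTree_eq (.cut hc (hrep hl) (hrep hr'))]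
        exact .cut (fun hN => (hM []).1 hN _ hr) h₁ h₂
      · exact mk _ _ _ _ hr' h₂ rfl (fun _ => rfl) (by simp)
    · exact mk _ _ _ _ hl h₁ rfl (fun _ => rfl) (by simp)
  | @box A Θ h hA hl =>
    by_cases h₁ : Good mainTree M ⟨c'.ctx, Θ, {A}⟩ (.leaf (t.sub false)) (.leaf (t.sub false))
    · refine absurd ?_ hbad
      rw [Represents.mainTree_eq (.box hc hl)]
      obtain ⟨h₂, h₃⟩ := (hM []).modalData_spec hc trivial h hl rfl
      exact .box h₂ hA (layer_none_left.2 (by rw [← h₃]; exact h₁))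
    · exact hG _ _ hl h₁ trivial (by simp)
  | @boxPlus A Θ h hA hl hr' =>
    by_cases h₁ : Good mainTree M ⟨c'.ctx, Θ, {A}⟩ (.leaf (t.sub false)) (.leaf (t.sub false))
    · by_cases h₂ : layer (Good mainTree M) (Frag mainTree M (Good mainTree M) s i) s (some A)
        ⟨c'.ctx, Θ, {Formula.boxPlus A}⟩
        (.leaf (t.sub true)) (.leaf (t.sub true))
      · refine absurd ?_ hbad
        rw [Represents.mainTree_eq (.boxPlus hc hl)]
        obtain ⟨h₃, h₄⟩ := (hM []).modalData_spec hc trivial h hl rfl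
        exact .boxPlus h₃ hA (layer_none_left.2 (by rw [← h₄]; exact h₁)) (by rw [← h₄]; exact h₂)
      · by_cases hs : some A = s
        · simp only [layer, hs, ne_eq, and_true] at h₂
          rw [if_pos (by simp [← hs])] at h₂
          exact mk _ _ _ _ hr' h₂ (by simp [Rule.next, hs]) (fun h => absurd trivial h)
            fun _ _ _ _ => rfl
        · simp only [layer, hs, and_false, if_false] at h₂
          exact hG _ _ hr' h₂ trivial fun C hC _ hs' => by cases hC; exact hs hs'.symm
    · exact hG _ _ hl h₁ trivial (by simp)

open Classical in
-- A path of bad states is an infinite branch. In its good tail the annotation stabilises, and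
-- afterwards the failing index never grows and drops at each of the infinitely many applications of
-- □⁺.
theorem IsProof.good (ht : t.IsProof) (hM : ∀ w, t.Allowed M w) (hc : t.seqAt [] = some c) :
    Good mainTree M c (.leaf t) (.leaf t) := by
  by_contra hn
  obtain ⟨i₀, hi₀⟩ : ∃ i, ¬ Frag mainTree M (Good mainTree M) none i c (.leaf t) (.leaf t) := by
    by_contra! h
    exact hn (Good.mk none h)
  obtain ⟨f, σ, h₀, hR, hσ⟩ := exists_path BadState.tree (fun σ b σ' => ∃ r, BadStep σ b σ' r)
    BadState.exists_step ⟨t, c, none, i₀, ht, hM, hc, hi₀⟩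
  have hσ' : ∀ n, (σ n).tree [] = t (pathPrefix f n) := fun n => by simpa using hσ n []
  obtain ⟨N, A, ha, hb, hcc, hd⟩ := ht.branch f fun n => hσ' n ▸ (σ n).proof.root_mem
  choose r hr using hR
  have hrule : ∀ n, t.ruleAt (pathPrefix f n) = some (r n) := fun n => by
    rw [← (hr n).rule]; simp [ruleAt, hσ']
  obtain ⟨n₀, hn₀, B, hB, hft⟩ := hb N
  -- The step `n₀` enters a right premise of □⁺ inside the tail, which sets the annotation to A;
  -- conditions (a), (c) and (d) then preserve it.
  have hann : ∀ k, (σ (n₀ + 1 + k)).ann = some A := by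
    intro k
    induction k with
    | zero =>
      obtain rfl := ha n₀ hn₀ B hB
      have := (hr n₀).ann
      rw [hrule] at hB
      rw [Option.some.inj hB, hft] at this
      simpa [Rule.next] using this
    | succ k ih =>
      have hle : n₀ + 1 + k ≥ N := by omega
      rw [← add_assoc, (hr _).ann, ih]
      have h₁ := ha _ hle
      have h₂ := hcc _ hle
      have h₃ := hd _ hle
      rw [hrule] at h₁ h₂ h₃
      cases e : r (n₀ + 1 + k) with
      | boxPlus C =>
        rw [e] at h₁ h₂
        have := h₂ C rfl
        rw [ne_eq, Bool.not_eq_false] at this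
        simp [Rule.next, this, h₁ C rfl]
      | box C => rw [e] at h₃; exact absurd rfl (h₃ C)
      | _ => rfl
  have hstep : ∀ k, (σ (n₀ + 1 + (k + 1))).idx +
      (if ∃ C, r (n₀ + 1 + k) = .boxPlus C then 1 else 0) = (σ (n₀ + 1 + k)).idx := by
    intro k
    have hle : n₀ + 1 + k ≥ N := by omega
    have h₁ := ha _ hle
    have h₂ := hcc _ hle
    have h₃ := hd _ hle
    rw [hrule] at h₁ h₂ h₃
    have h₄ := hr (n₀ + 1 + k)
    cases e : r (n₀ + 1 + k) with
    | boxPlus C =>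
      rw [e] at h₁ h₂
      have h₅ := h₂ C rfl
      rw [ne_eq, Bool.not_eq_false] at h₅
      rw [if_pos ⟨C, rfl⟩]
      exact h₄.idx_boxPlus C e h₅ (by rw [hann k, h₁ C rfl])
    | box C => rw [e] at h₃; exact absurd rfl (h₃ C)
    | _ =>
      rw [if_neg (by simp)]
      exact h₄.idx (by simp [e, Rule.IsModal])
  have hanti : ∀ k j, (σ (n₀ + 1 + (k + j))).idx ≤ (σ (n₀ + 1 + k)).idx := by
    intro k j
    induction j with
    | zero => exact le_rfl
    | succ j ih => exact (Nat.le_of_add_right_le (hstep (k + j)).le).trans ih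
  have hdesc : ∀ j, ∃ k, (σ (n₀ + 1 + k)).idx + j ≤ (σ (n₀ + 1)).idx := by
    intro j
    induction j with
    | zero => exact ⟨0, le_rfl⟩
    | succ j ih =>
      obtain ⟨k, hk⟩ := ih
      obtain ⟨n, hn, C, hC, -⟩ := hb (n₀ + 1 + k)
      obtain ⟨l, rfl⟩ : ∃ l, n = n₀ + 1 + (k + l) := ⟨n - (n₀ + 1 + k), by omega⟩
      rw [hrule] at hC
      have h₁ := hstep (k + l)
      rw [if_pos ⟨C, Option.some.inj hC⟩] at h₁
      have h₂ := hanti k l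
      exact ⟨k + l + 1, by omega⟩
  obtain ⟨k, hk⟩ := hdesc ((σ (n₀ + 1)).idx + 1)
  omega

end SeqTree

/-! ### Levels and fragments by recursion on the path -/

section Levels

variable {t t' : SeqTree} {s : Annot} {n i : ℕ} {b : Bool} {w : List Bool} {A : Formula} {M : Mode}
  {c : Sequent}

/-- The annotation of an immediate successor of the root. -/
def nextAnn (t : SeqTree) (s : Annot) (b : Bool) : Annot :=
  ((t.ruleAt []).map (Rule.next s b)).getD s

theorem annAt_cons : annAt t s (b :: w) = annAt (t.sub b) (nextAnn t s b) w := rfl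

theorem equivRoot_cons : EquivRoot t s (b :: w) ↔ (∀ A, t.ruleAt [] ≠ some (.box A)) ∧
    (∀ A, t.ruleAt [] = some (.boxPlus A) → b ≠ false) ∧ nextAnn t s b = s ∧
      EquivRoot (t.sub b) s w := by
  constructor
  · intro h
    obtain ⟨h₁, h₂, h₃⟩ := h [] b ⟨w, rfl⟩
    refine ⟨h₁, h₂, h₃, fun v b' hv => ?_⟩
    obtain ⟨h₄, h₅, h₆⟩ := h (b :: v) b' ((List.prefix_cons_inj b).2 hv)
    refine ⟨h₄, h₅, ?_⟩
    rw [List.cons_append, annAt_cons, show nextAnn t s b = s from h₃] at h₆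
    exact h₆
  · rintro ⟨h₁, h₂, h₃, h₄⟩ v b' hv
    cases v with
    | nil =>
      obtain rfl : b' = b := by simpa using hv
      exact ⟨h₁, h₂, h₃⟩
    | cons b'' v =>
      rw [List.cons_append, List.cons_prefix_cons] at hv
      obtain ⟨rfl, hv⟩ := hv
      obtain ⟨h₅, h₆, h₇⟩ := h₄ v b' hv
      refine ⟨h₅, h₆, ?_⟩
      rw [List.cons_append, annAt_cons, h₃]
      exact h₇

theorem finite_boxPlus_prefixes (t : SeqTree) (w : List Bool) :
    {v : List Bool | v <+: w ∧ v ≠ w ∧ ∃ A, t.ruleAt v = some (Rule.boxPlus A)}.Finite :=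
  (List.finite_toSet w.inits).subset fun _ hv => (List.mem_inits _ _).2 hv.1

theorem boxPlusCount_nil : boxPlusCount t [] = 0 := by
  rw [boxPlusCount, Set.ncard_eq_zero (finite_boxPlus_prefixes t [])]
  exact Set.eq_empty_of_forall_notMem fun v hv => hv.2.1 (List.prefix_nil.1 hv.1)

/-- The removed empty prefix accounts for the only possible difference between the two counts. -/
theorem boxPlus_prefixes_cons (t : SeqTree) (b : Bool) (w : List Bool) :
    {v : List Bool | v <+: b :: w ∧ v ≠ b :: w ∧ ∃ A, t.ruleAt v = some (Rule.boxPlus A)} \ {[]} =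
      List.cons b '' {v | v <+: w ∧ v ≠ w ∧ ∃ A, (t.sub b).ruleAt v = some (Rule.boxPlus A)} := by
  ext v
  cases v with
  | nil => simp
  | cons b' v =>
    simp only [Set.mem_sdiff, Set.mem_ofPred_eq, List.cons_prefix_cons, Set.mem_singleton_iff,
      Set.mem_image, List.cons.injEq]
    constructor
    · rintro ⟨⟨⟨rfl, h₁⟩, h₂, h₃⟩, -⟩
      exact ⟨v, ⟨h₁, fun h => h₂ (by rw [h]), h₃⟩, rfl, rfl⟩
    · rintro ⟨u, ⟨h₁, h₂, h₃⟩, rfl, rfl⟩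
      exact ⟨⟨⟨rfl, h₁⟩, fun h => h₂ (List.cons.inj h).2, h₃⟩, by simp⟩

theorem boxPlusCount_cons_of_ne (h : ∀ A, t.ruleAt [] ≠ some (.boxPlus A)) :
    boxPlusCount t (b :: w) = boxPlusCount (t.sub b) w := by
  have := boxPlus_prefixes_cons t b w
  rw [Set.sdiff_singleton_eq_self (by simp [h])] at this
  rw [boxPlusCount, this, Set.ncard_image_of_injective _ (List.cons_injective)]
  rfl

theorem boxPlusCount_cons (h : t.ruleAt [] = some (.boxPlus A)) :
    boxPlusCount t (b :: w) = boxPlusCount (t.sub b) w + 1 := by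
  have := congrArg Set.ncard (boxPlus_prefixes_cons t b w)
  rw [Set.ncard_image_of_injective _ (List.cons_injective)] at this
  rw [boxPlusCount, ← Set.ncard_sdiff_singleton_add_one (a := []) _ (finite_boxPlus_prefixes t _),
    this]
  · rfl
  · exact ⟨List.nil_prefix, by simp, A, h⟩

theorem not_isLevelPremise_nil : ¬ IsLevelPremise t s n [] := by
  rintro ⟨⟨v, A, h, -⟩, -⟩
  simp at h

theorem isLevelPremise_cons_of_not_modal (h : ∀ r, t.ruleAt [] = some r → ¬ r.IsModal) :
    IsLevelPremise t s n (b :: w) ↔ IsLevelPremise (t.sub b) s n w := by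
  have h₁ : ∀ A, t.ruleAt [] ≠ some (.boxPlus A) := fun A hA => h _ hA trivial
  have h₂ : ∀ A, t.ruleAt [] ≠ some (.box A) := fun A hA => h _ hA trivial
  have h₃ : nextAnn t s b = s := by
    unfold nextAnn
    cases e : t.ruleAt [] with
    | none => rfl
    | some r => cases r <;> first | rfl | exact absurd e (h₁ _) | exact absurd e (h₂ _)
  rw [IsLevelPremise, IsLevelPremise, equivRoot_cons, boxPlusCount_cons_of_ne h₁]
  refine and_congr ⟨?_, ?_⟩ (and_congr_left fun _ => ?_)
  · rintro ⟨v, A, e, hv⟩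
    cases v with
    | nil => exact absurd hv (h₁ A)
    | cons b' v =>
      obtain ⟨rfl, rfl⟩ := List.cons.inj e
      exact ⟨v, A, rfl, hv⟩
  · rintro ⟨v, A, rfl, hv⟩
    exact ⟨b :: v, A, rfl, hv⟩
  · exact ⟨fun h => h.2.2.2, fun h => ⟨h₂, fun A hA => absurd hA (h₁ A), h₃, h⟩⟩

theorem not_isLevelPremise_cons_of_box (h : t.ruleAt [] = some (.box A)) :
    ¬ IsLevelPremise t s n (b :: w) :=
  fun ⟨_, h', _⟩ => (equivRoot_cons.1 h').1 A h

theorem not_isLevelPremise_cons_of_boxPlus (h : t.ruleAt [] = some (.boxPlus A))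
    (hs : ¬ (b = true ∧ s = some A)) : ¬ IsLevelPremise t s n (b :: w) := by
  rintro ⟨_, h', _⟩
  obtain ⟨-, h₁, h₂, -⟩ := equivRoot_cons.1 h'
  have hb : b = true := by simpa using h₁ A h
  exact hs ⟨hb, by rw [← h₂]; simp [nextAnn, h, Rule.next, hb]⟩

/-- One level is consumed at the root. The first alternative is the right premise of the root
itself, which has level 1. -/
theorem isLevelPremise_cons_of_boxPlus (h : t.ruleAt [] = some (.boxPlus A)) :
    IsLevelPremise t (some A) (n + 1) (true :: w) ↔
      w = [] ∧ n = 0 ∨ IsLevelPremise (t.sub true) (some A) n w := by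
  have h₁ : nextAnn t (some A) true = some A := by simp [nextAnn, h, Rule.next]
  rw [IsLevelPremise, equivRoot_cons, boxPlusCount_cons h, add_left_inj]
  constructor
  · rintro ⟨⟨v, B, e, hv⟩, ⟨-, -, -, h₂⟩, h₃⟩
    cases v with
    | nil =>
      obtain rfl : w = [] := by simpa using e
      exact Or.inl ⟨rfl, by rw [← h₃, boxPlusCount_nil]⟩
    | cons b' v =>
      obtain ⟨rfl, rfl⟩ := List.cons.inj e
      exact Or.inr ⟨⟨v, B, rfl, hv⟩, h₂, h₃⟩
  · rintro (⟨rfl, rfl⟩ | ⟨⟨v, B, rfl, hv⟩, h₂, h₃⟩)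
    · exact ⟨⟨[], A, rfl, h⟩, ⟨by simp [h], by simp, h₁, fun v b hv => by simp at hv⟩,
        boxPlusCount_nil⟩
    · exact ⟨⟨true :: v, B, rfl, hv⟩, ⟨by simp [h], by simp, h₁, h₂⟩, h₃⟩

theorem inFragment_nil : InFragment t s n [] ↔ (t []).isSome := by
  refine and_iff_left fun v hv => ?_
  rw [List.prefix_nil.1 hv]
  exact not_isLevelPremise_nil

theorem inFragment_cons : InFragment t s n (b :: w) ↔
    (t (b :: w)).isSome ∧ ∀ v, v <+: w → ¬ IsLevelPremise t s n (b :: v) := by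
  refine and_congr_right fun _ => ⟨fun h v hv => h _ ((List.prefix_cons_inj b).2 hv), ?_⟩
  intro h v hv
  cases v with
  | nil => exact not_isLevelPremise_nil
  | cons b' v =>
    obtain ⟨rfl, hv'⟩ := List.cons_prefix_cons.1 hv
    exact h v hv'

end Levels

namespace SeqTree

open Classical in
/-- The labels of the `n`-fragment of the tree annotated with `s`. -/
noncomputable def trunc : SeqTree → Annot → ℕ → SeqTree
  | t, _, _, [] => t []
  | t, s, n, b :: w =>
    if ∃ A, t.ruleAt [] = some (.box A) ∨
        t.ruleAt [] = some (.boxPlus A) ∧ ¬ (b = true ∧ s = some A) then t (b :: w)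
    else if ∃ A, t.ruleAt [] = some (.boxPlus A) then
      -- At level 1 the right premise is cut off. The value at n = 0 is a convention; `trunc_eq`
      -- assumes n > 0.
      if n ≤ 1 then none else trunc (t.sub b) s (n - 1) w
    else trunc (t.sub b) s n w

variable {t t' : SeqTree} {s : Annot} {n i : ℕ} {b : Bool} {w : List Bool} {A : Formula} {M : Mode}
  {c : Sequent} {r : Rule}

theorem trunc_nil : t.trunc s n [] = t [] := rfl

theorem trunc_cons_of_not_modal (h : ∀ r, t.ruleAt [] = some r → ¬ r.IsModal) :
    t.trunc s n (b :: w) = (t.sub b).trunc s n w := by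
  have h₁ : ∀ A, t.ruleAt [] ≠ some (.boxPlus A) := fun A hA => h _ hA trivial
  have h₂ : ∀ A, t.ruleAt [] ≠ some (.box A) := fun A hA => h _ hA trivial
  simp [trunc, h₁, h₂]

theorem trunc_cons_of_box (h : t.ruleAt [] = some (.box A)) : t.trunc s n (b :: w) = t (b :: w) := by
  simp [trunc, h]

theorem trunc_cons_of_boxPlus (h : t.ruleAt [] = some (.boxPlus A))
    (hs : ¬ (b = true ∧ s = some A)) : t.trunc s n (b :: w) = t (b :: w) := by
  rw [trunc, if_pos ⟨A, Or.inr ⟨h, hs⟩⟩]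

theorem trunc_one_cons (h : t.ruleAt [] = some (.boxPlus A)) :
    t.trunc (some A) 1 (true :: w) = none := by
  simp [trunc, h]

theorem trunc_add_two_cons (h : t.ruleAt [] = some (.boxPlus A)) :
    t.trunc (some A) (n + 2) (true :: w) = (t.sub true).trunc (some A) (n + 1) w := by
  simp [trunc, h]

open Classical in
theorem trunc_eq (hn : 0 < n) : t.trunc s n w = if InFragment t s n w then t w else none := by
  -- Once the path leaves the class of the root, no level premise occurs on it and the fragment
  -- keeps everything.
  have full : ∀ {t : SeqTree} {n b w}, (∀ v, ¬ IsLevelPremise t s n (b :: v)) →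
      t (b :: w) = if InFragment t s n (b :: w) then t (b :: w) else none := by
    intro t n b w h
    split_ifs with hf
    · rfl
    · cases e : t (b :: w) with
      | none => rfl
      | some l => exact absurd (inFragment_cons.2 ⟨by simp [e], fun v _ => h v⟩) hf
  have part : ∀ {t : SeqTree} {n m b w}, (∀ v, v <+: w → (IsLevelPremise t s n (b :: v) ↔
      IsLevelPremise (t.sub b) s m v)) → (InFragment (t.sub b) s m w ↔ InFragment t s n (b :: w)) := by
    intro t n m b w h
    rw [inFragment_cons]
    exact and_congr_right fun _ => forall₂_congr fun v hv => not_congr (h v hv).symm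
  induction w generalizing t n with
  | nil =>
    rw [trunc_nil]
    split_ifs with h
    · rfl
    · rw [inFragment_nil] at h; simpa using h
  | cons b w ih =>
    by_cases hm : ∀ r, t.ruleAt [] = some r → ¬ r.IsModal
    · rw [trunc_cons_of_not_modal hm, ih hn]
      simp only [part (t := t) (n := n) fun v _ => isLevelPremise_cons_of_not_modal hm]
      rfl
    · push Not at hm
      obtain ⟨r, hr, hm⟩ := hm
      cases r with
      | box A =>
        rw [trunc_cons_of_box hr]
        exact full fun v => not_isLevelPremise_cons_of_box hr
      | boxPlus A =>
        by_cases hs : b = true ∧ s = some A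
        · obtain ⟨rfl, rfl⟩ := hs
          obtain ⟨n, rfl⟩ : ∃ k, n = k + 1 := ⟨n - 1, by omega⟩
          cases n with
          | zero =>
            rw [trunc_one_cons hr, if_neg]
            rw [inFragment_cons]
            exact fun h => h.2 [] List.nil_prefix
              ((isLevelPremise_cons_of_boxPlus hr).2 (Or.inl ⟨rfl, rfl⟩))
          | succ n =>
            rw [trunc_add_two_cons hr, ih (Nat.succ_pos n)]
            simp only [part (t := t) (n := n + 1 + 1) (m := n + 1) fun v _ =>
              (isLevelPremise_cons_of_boxPlus hr).trans (by simp)]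
            rfl
        · rw [trunc_cons_of_boxPlus hr hs]
          exact full fun v => not_isLevelPremise_cons_of_boxPlus hr hs
      | _ => exact hm.elim

theorem isSome_trunc (hn : 0 < n) : (t.trunc s n w).isSome ↔ InFragment t s n w := by
  rw [trunc_eq hn]
  split_ifs with h
  · exact iff_of_true h.1 h
  · exact iff_of_false (by simp) h

theorem fragment_eq (hn : 0 < n) :
    fragment t s n w = (t.trunc s n w).map fun l => (annAt t s w, l) := by
  rw [trunc_eq hn, fragment]
  split_ifs <;> rfl

/-- The relation between immediate subtrees of trees with the same `n`-fragment. -/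
theorem trunc_sub (h : t.trunc s n = t'.trunc s n) (b : Bool) :
    ((∀ r, t.ruleAt [] = some r → ¬ r.IsModal) ∧ (t.sub b).trunc s n = (t'.sub b).trunc s n) ∨
    (∃ A, t.ruleAt [] = some (.box A)) ∧ t.sub b = t'.sub b ∨
    ∃ A, t.ruleAt [] = some (.boxPlus A) ∧ (¬ (b = true ∧ s = some A) ∧ t.sub b = t'.sub b ∨
      (b = true ∧ s = some A) ∧
        (n ≤ 1 ∨ 2 ≤ n ∧ (t.sub true).trunc s (n - 1) = (t'.sub true).trunc s (n - 1))) := by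
  have h₀ : t.ruleAt [] = t'.ruleAt [] := congrArg (Option.map Prod.snd) (congrFun h [])
  by_cases hm : ∀ r, t.ruleAt [] = some r → ¬ r.IsModal
  · refine Or.inl ⟨hm, funext fun w => ?_⟩
    rw [← trunc_cons_of_not_modal hm, ← trunc_cons_of_not_modal (h₀ ▸ hm), h]
  · push Not at hm
    obtain ⟨r, hr, hm⟩ := hm
    cases r with
    | box A =>
      refine Or.inr (Or.inl ⟨⟨A, hr⟩, funext fun w => ?_⟩)
      have := congrFun h (b :: w)
      rwa [trunc_cons_of_box hr, trunc_cons_of_box (h₀ ▸ hr)] at this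
    | boxPlus A =>
      refine Or.inr (Or.inr ⟨A, hr, ?_⟩)
      by_cases hs : b = true ∧ s = some A
      · refine Or.inr ⟨hs, ?_⟩
        obtain ⟨rfl, rfl⟩ := hs
        rcases Nat.lt_or_ge 1 n with hn | hn
        · obtain ⟨n, rfl⟩ : ∃ k, n = k + 2 := ⟨n - 2, by omega⟩
          refine Or.inr ⟨by omega, funext fun w => ?_⟩
          have := congrFun h (true :: w)
          rwa [trunc_add_two_cons hr, trunc_add_two_cons (h₀ ▸ hr)] at this
        · exact Or.inl hn
      · refine Or.inl ⟨hs, funext fun w => ?_⟩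
        have := congrFun h (b :: w)
        rwa [trunc_cons_of_boxPlus hr hs, trunc_cons_of_boxPlus (h₀ ▸ hr) hs] at this
    | _ => exact hm.elim

/-- An annotation depends only on the rules strictly below the node, and these belong to the
fragment. Hence comparing the labels of fragments is enough. -/
theorem annAt_eq_of_trunc_eq (h : t.trunc s n = t'.trunc s n) (hn : 0 < n)
    (hw : (t.trunc s n w).isSome) (a : Annot) : annAt t a w = annAt t' a w := by
  induction w generalizing t t' n a with
  | nil => rfl
  | cons b w ih =>
    have h₀ : t.ruleAt [] = t'.ruleAt [] := congrArg (Option.map Prod.snd) (congrFun h [])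
    rw [annAt_cons, annAt_cons, nextAnn, nextAnn, ← h₀]
    rcases trunc_sub h b with ⟨h₁, h₂⟩ | ⟨-, h₂⟩ | ⟨A, h₁, ⟨-, h₂⟩ | ⟨⟨rfl, rfl⟩, h₂ | ⟨h₂, h₃⟩⟩⟩
    · exact ih h₂ hn (by rwa [← trunc_cons_of_not_modal h₁]) _
    · rw [h₂]
    · rw [h₂]
    · obtain rfl : n = 1 := by omega
      rw [trunc_one_cons h₁] at hw
      simp at hw
    · obtain ⟨n, rfl⟩ : ∃ k, n = k + 2 := ⟨n - 2, by omega⟩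
      exact ih h₃ (by omega) (by rwa [trunc_add_two_cons h₁] at hw) _

theorem fragment_eq_iff (hn : 0 < n) :
    fragment t s n = fragment t' s n ↔ t.trunc s n = t'.trunc s n := by
  constructor
  · intro h
    funext w
    have := congrArg (Option.map Prod.snd) (congrFun h w)
    simpa [fragment_eq hn, Option.map_map, Function.comp_def] using this
  · intro h
    funext w
    rw [fragment_eq hn, fragment_eq hn, ← h]
    cases e : t.trunc s n w with
    | none => rfl
    | some l =>
      simp only [Option.map_some]
      rw [annAt_eq_of_trunc_eq h hn (by simp [e])]

theorem allowed_of_eq_none (h : t w = none) : t.Allowed M w := by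
  refine ⟨fun _ A => by simp [ruleAt, h], fun _ c r p hc => ?_⟩
  rw [h] at hc
  cases hc

theorem allowed_of_isSome (h : (t w).isSome → t.Allowed M w) : t.Allowed M w := by
  cases e : t w with
  | none => exact allowed_of_eq_none e
  | some l => exact h (by simp [e])

theorem trunc_sub_of_not_modal (h : t.trunc s n = t'.trunc s n)
    (hm : ∀ r, t.ruleAt [] = some r → ¬ r.IsModal) (b : Bool) :
    (t.sub b).trunc s n = (t'.sub b).trunc s n := by
  rcases trunc_sub h b with h | ⟨⟨A, h⟩, -⟩ | ⟨A, h, -⟩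
  · exact h.2
  · exact absurd trivial (hm _ h)
  · exact absurd trivial (hm _ h)

/-- Induction on the level, then on the main tree. Premises outside the class of the root lie in the
fragment with all their descendants, so they coincide and `IsProof.good` applies; a right premise
that retains s is one level lower. -/
theorem IsProof.frag_leaf (ht : t.IsProof) (ht' : t'.IsProof) (hc : t.seqAt [] = some c)
    (h : t.trunc s (i + 1) = t'.trunc s (i + 1))
    (hM : ∀ w, (t.trunc s (i + 1) w).isSome → t.Allowed M w) :
    Frag mainTree M (Good mainTree M) s (i + 1) c (.leaf t) (.leaf t') := by
  induction i using Nat.strong_induction_on generalizing t t' c with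
  | _ i ih =>
    change Derives M _ _ _ _ t.mainTree t'.mainTree
    have hrep := ht.represents
    generalize t.mainTree = m at hrep
    induction hrep generalizing t' c with
    | @ax t c' hr =>
      obtain rfl : c' = c := by simpa [seqAt, hr] using hc
      have hr' : t' [] = _ := (congrFun h []).symm.trans hr
      rw [Represents.mainTree_eq (.ax hr')]
      cases ht.rootStep hr with
      | ax h => exact .ax h
    | @impL t c' A B l r hr _ _ ihl ihr =>
      obtain rfl : c' = c := by simpa [seqAt, hr] using hc
      have hr' : t' [] = _ := (congrFun h []).symm.trans hr
      have hm : ∀ r, t.ruleAt [] = some r → ¬ r.IsModal := by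
        simp [ruleAt, hr, Rule.IsModal]
      have hsub := trunc_sub_of_not_modal h hm
      have hseq : ∀ b, t'.seqAt [b] = t.seqAt [b] := fun b =>
        congrArg (Option.map Prod.fst) (congrFun (hsub b) []).symm
      have hMs : ∀ b w, ((t.sub b).trunc s _ w).isSome → (t.sub b).Allowed M w := fun b w hw =>
        hM (b :: w) (by rwa [trunc_cons_of_not_modal hm])
      cases ht.rootStep hr with
      | impL e hl hr₁ =>
        have hl' := ht'.sub ((hseq _).trans hl)
        have hr₁' := ht'.sub ((hseq _).trans hr₁)
        rw [Represents.mainTree_eq (.impL hr' hl'.represents hr₁'.represents)]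
        exact .impL e (ihl (ht.sub hl) hl' hl (hsub _) (hMs _))
          (ihr (ht.sub hr₁) hr₁' hr₁ (hsub _) (hMs _))
    | @impR t c' A B l hr _ ihl =>
      obtain rfl : c' = c := by simpa [seqAt, hr] using hc
      have hr' : t' [] = _ := (congrFun h []).symm.trans hr
      have hm : ∀ r, t.ruleAt [] = some r → ¬ r.IsModal := by
        simp [ruleAt, hr, Rule.IsModal]
      have hsub := trunc_sub_of_not_modal h hm
      have hseq : ∀ b, t'.seqAt [b] = t.seqAt [b] := fun b =>
        congrArg (Option.map Prod.fst) (congrFun (hsub b) []).symm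
      have hMs : ∀ b w, ((t.sub b).trunc s _ w).isSome → (t.sub b).Allowed M w := fun b w hw =>
        hM (b :: w) (by rwa [trunc_cons_of_not_modal hm])
      cases ht.rootStep hr with
      | impR e hl =>
        have hl' := ht'.sub ((hseq _).trans hl)
        rw [Represents.mainTree_eq (.impR hr' hl'.represents)]
        exact .impR e (ihl (ht.sub hl) hl' hl (hsub _) (hMs _))
    | @cut t c' A l r hr _ _ ihl ihr =>
      obtain rfl : c' = c := by simpa [seqAt, hr] using hc
      have hr' : t' [] = _ := (congrFun h []).symm.trans hr
      have hm : ∀ r, t.ruleAt [] = some r → ¬ r.IsModal := by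
        simp [ruleAt, hr, Rule.IsModal]
      have hsub := trunc_sub_of_not_modal h hm
      have hseq : ∀ b, t'.seqAt [b] = t.seqAt [b] := fun b =>
        congrArg (Option.map Prod.fst) (congrFun (hsub b) []).symm
      have hMs : ∀ b w, ((t.sub b).trunc s _ w).isSome → (t.sub b).Allowed M w := fun b w hw =>
        hM (b :: w) (by rwa [trunc_cons_of_not_modal hm])
      cases ht.rootStep hr with
      | cut hl hr₁ =>
        have hl' := ht'.sub ((hseq _).trans hl)
        have hr₁' := ht'.sub ((hseq _).trans hr₁)
        rw [Represents.mainTree_eq (.cut hr' hl'.represents hr₁'.represents)]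
        exact .cut (fun hN => (hM [] (by simp [trunc_nil, hr])).1 hN A (by simp [ruleAt, hr]))
          (ihl (ht.sub hl) hl' hl (hsub _) (hMs _)) (ihr (ht.sub hr₁) hr₁' hr₁ (hsub _) (hMs _))
    | @box t c' d A hr hd =>
      obtain rfl : c' = c := by simpa [seqAt, hr] using hc
      have hr' : t' [] = _ := (congrFun h []).symm.trans hr
      have hrule : t.ruleAt [] = some (.box A) := by simp [ruleAt, hr]
      have hsub : t.sub false = t'.sub false := by
        rcases trunc_sub h false with ⟨h, -⟩ | h | ⟨B, h, -⟩
        · exact absurd trivial (h _ hrule)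
        · exact h.2
        · rw [hrule] at h; cases h
      cases ht.rootStep hr with
      | @box _ Θ hms hA hl =>
        have hl' : t'.seqAt [false] = some _ :=
          (congrArg (fun u => seqAt u []) hsub).symm.trans hl
        obtain rfl := Option.some.inj (hd.symm.trans hl)
        rw [Represents.mainTree_eq (.box hr' hl'), ← hsub]
        obtain ⟨h₂, h₃⟩ := (hM [] (by simp [trunc_nil, hr])).modalData_spec hr trivial hms hl rfl
        refine .box h₂ hA (layer_none_left.2 ?_)
        rw [← h₃]
        exact (ht.sub hl).good (fun w => allowed_of_isSome fun hw => hM (false :: w)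
          (by rwa [trunc_cons_of_box hrule])) hl
    | @boxPlus t c' d A hr hd =>
      obtain rfl : c' = c := by simpa [seqAt, hr] using hc
      have hr' : t' [] = _ := (congrFun h []).symm.trans hr
      have hrule : t.ruleAt [] = some (.boxPlus A) := by simp [ruleAt, hr]
      have hrule' : t'.ruleAt [] = some (.boxPlus A) := by simp [ruleAt, hr']
      have hsub : ∀ b, ¬ (b = true ∧ s = some A) → t.sub b = t'.sub b := fun b hb => by
        funext w
        have := congrFun h (b :: w)
        rwa [trunc_cons_of_boxPlus hrule hb, trunc_cons_of_boxPlus hrule' hb] at this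
      cases ht.rootStep hr with
      | @boxPlus _ Θ hms hA hl hr₁ =>
        have hl' : t'.seqAt [false] = some _ :=
          (congrArg (fun u => seqAt u []) (hsub false (by simp))).symm.trans hl
        obtain rfl := Option.some.inj (hd.symm.trans hl)
        rw [Represents.mainTree_eq (.boxPlus hr' hl'), ← hsub false (by simp)]
        obtain ⟨h₂, h₃⟩ := (hM [] (by simp [trunc_nil, hr])).modalData_spec hr trivial hms hl rfl
        have hgood : ∀ {b d}, t.seqAt [b] = some d → ¬ (b = true ∧ s = some A) →
            Good mainTree M d (.leaf (t.sub b)) (.leaf (t.sub b)) := fun {b d} hd hb =>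
          (ht.sub hd).good (fun w => allowed_of_isSome fun hw => hM (b :: w)
            (by rwa [trunc_cons_of_boxPlus hrule hb])) hd
        refine .boxPlus h₂ hA (layer_none_left.2 ?_) ?_
        · rw [← h₃]
          exact hgood hl (by simp)
        rw [← h₃, layer]
        split_ifs with hs
        rotate_left
        · have hs' : ¬ (true = true ∧ s = some A) := fun h => hs ⟨by simp, h.2.symm⟩
          rw [← hsub true hs']
          exact hgood hr₁ hs'
        obtain rfl := hs.2
        cases i with
        -- This right premise is removed from the 1-fragment, and nothing has to be known about it.
        | zero => trivial
        | succ i =>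
          have hr₂ : ∀ b, t'.seqAt [b] = t.seqAt [b] := fun b => by
            cases b with
            | false => exact hl'.trans hl.symm
            | true =>
              have := congrFun h [true]
              rw [trunc_add_two_cons hrule, trunc_add_two_cons hrule'] at this
              exact congrArg (Option.map Prod.fst) this.symm
          refine ih i (Nat.lt_succ_self i) (ht.sub hr₁) (ht'.sub ((hr₂ _).trans hr₁)) hr₁
            (funext fun w => ?_) fun w hw => ?_
          · rw [← trunc_add_two_cons hrule, h, trunc_add_two_cons hrule']
          · exact hM (true :: w) (by rwa [trunc_add_two_cons hrule])

end SeqTree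

/-! ### From terms back to trees of sequents -/

/-- The last rule of a tree. -/
def MainTree.rule {X : Type} : MainTree X → Rule
  | .ax => .ax
  | .impL A B _ _ => .impL A B
  | .impR A B _ => .impR A B
  | .cut A _ _ => .cut A
  | .box A _ _ _ _ => .box A
  | .boxPlus A _ _ _ _ _ => .boxPlus A

/-- The immediate subtrees of a derivation of the sequent `c`, together with their sequents. -/
noncomputable def MainTree.child (out : SeqTree → MainTree CutTerm) (c : Sequent) :
    MainTree CutTerm → Bool → Option (Sequent × MainTree CutTerm)
  | .impL A B l _, false => some (⟨c.ctx, B ::ₘ c.ant.erase (.imp A B), c.suc⟩, l)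
  | .impL A B _ r, true => some (⟨c.ctx, c.ant.erase (.imp A B), A ::ₘ c.suc⟩, r)
  | .impR A B t, false => some (⟨c.ctx, A ::ₘ c.ant, B ::ₘ c.suc.erase (.imp A B)⟩, t)
  | .cut A l _, false => some (⟨c.ctx, c.ant, A ::ₘ c.suc⟩, l)
  | .cut A _ r, true => some (⟨c.ctx, A ::ₘ c.ant, c.suc⟩, r)
  | .box A S₀ L P x, false => some (⟨c.ctx, premAnt S₀ L P, {A}⟩, x.head out)
  | .boxPlus A S₀ L P x _, false => some (⟨c.ctx, premAnt S₀ L P, {A}⟩, x.head out)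
  | .boxPlus A S₀ L P _ y, true => some (⟨c.ctx, premAnt S₀ L P, {Formula.boxPlus A}⟩, y.head out)
  | _, _ => none

/-- The tree of sequents with the sequent `c` at the root. -/
noncomputable def MainTree.render (out : SeqTree → MainTree CutTerm) :
    Sequent → MainTree CutTerm → SeqTree
  | c, m, [] => some (c, m.rule)
  | c, m, b :: w => (m.child out c b).bind fun p => MainTree.render out p.1 p.2 w

section Render

variable {out : SeqTree → MainTree CutTerm} {M : Mode}
  {ρ : Annot → Sequent → CutTerm → CutTerm → Prop} {c : Sequent} {m m' : MainTree CutTerm}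
  {s : Annot} {i : ℕ} {t t' : CutTerm} {b : Bool}

open MainTree

/-- The relation between immediate subtrees of two related derivations. -/
inductive ChildRel (out : SeqTree → MainTree CutTerm) (M : Mode)
    (ρ : Annot → Sequent → CutTerm → CutTerm → Prop) (r : Rule) (b : Bool) :
    Option (Sequent × MainTree CutTerm) → Option (Sequent × MainTree CutTerm) → Prop
  | none : ChildRel out M ρ r b none none
  | same {d : Sequent} {n n' : MainTree CutTerm} (hr : ¬ r.IsModal)
      (h : Derives M ρ d.ctx d.ant d.suc n n') : ChildRel out M ρ r b (some (d, n)) (some (d, n'))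
  | modal {d : Sequent} {x x' : CutTerm} (hr : r.IsModal) (h : ρ (r.next none b) d x x') :
      ChildRel out M ρ r b (some (d, x.head out)) (some (d, x'.head out))

theorem Derives.rule_eq (h : Derives M ρ c.ctx c.ant c.suc m m') : m.rule = m'.rule := by
  cases h <;> rfl

theorem Derives.child (h : Derives M ρ c.ctx c.ant c.suc m m') (b : Bool) :
    ChildRel out M ρ m.rule b (m.child out c b) (m'.child out c b) := by
  cases h with
  | ax h => cases b <;> exact .none
  | impL e hl hr =>
    cases b
    · refine .same id ?_
      simpa [e] using hl
    · refine .same id ?_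
      simpa [e] using hr
  | impR e hl =>
    cases b
    · refine .same id ?_
      simpa [e] using hl
    · exact .none
  | cut hM hl hr =>
    cases b
    · exact .same id hl
    · exact .same id hr
  | box hm hA hx =>
    cases b
    · exact .modal trivial hx
    · exact .none
  | boxPlus hm hA hx hy =>
    cases b
    · exact .modal trivial hx
    · exact .modal trivial hy

theorem render_nil : render out c m [] = some (c, m.rule) := by
  rw [render]

theorem render_cons {w : List Bool} : render out c m (b :: w) =
    (m.child out c b).bind fun p => render out p.1 p.2 w := by
  rw [render]

theorem render_ruleAt_nil : (render out c m).ruleAt [] = some m.rule := by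
  simp [SeqTree.ruleAt, render_nil]

theorem render_seqAt_nil : (render out c m).seqAt [] = some c := by
  simp [SeqTree.seqAt, render_nil]

theorem render_seqAt_singleton : (render out c m).seqAt [b] = (m.child out c b).map Prod.fst := by
  rw [SeqTree.seqAt, render_cons]
  cases m.child out c b <;> simp [render_nil]

theorem render_sub {p : Sequent × MainTree CutTerm} (h : m.child out c b = some p) :
    (render out c m).sub b = render out p.1 p.2 := by
  funext w
  rw [SeqTree.sub, render_cons, h, Option.bind_some]

theorem render_sub_none (h : m.child out c b = none) : (render out c m).sub b = fun _ => none := by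
  funext w
  rw [SeqTree.sub, render_cons, h, Option.bind_none]

/-- Induction on the path: a step stays inside a main tree or enters a modal premise, where goodness
is unfolded again. -/
theorem Derives.render_eq (h : Derives M (fun _ => Good out M) c.ctx c.ant c.suc m m') :
    render out c m = render out c m' := by
  funext w
  induction w generalizing c m m' with
  | nil => rw [render_nil, render_nil, h.rule_eq]
  | cons b w ih =>
    rw [render_cons, render_cons]
    have := h.child (out := out) b
    generalize m.child out c b = p at this
    generalize m'.child out c b = p' at this
    cases this with
    | none => rfl
    | same hr h => exact ih h
    | modal hr h => exact ih h.derives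

/-- Premises outside the class of the root are good, hence equal in full. A right premise that
retains s is compared at a level lower by one, so i varies in the induction on the path. -/
theorem Derives.trunc_render_eq
    (h : Derives M (layer (Good out M) (Frag out M (Good out M) s i) s) c.ctx c.ant c.suc m m') :
    (render out c m).trunc s (i + 1) = (render out c m').trunc s (i + 1) := by
  funext w
  induction w generalizing c m m' i with
  | nil => rw [SeqTree.trunc_nil, SeqTree.trunc_nil, render_nil, render_nil, h.rule_eq]
  | cons b w ih =>
    have hc := h.child (out := out) b
    have hr : (render out c m).ruleAt [] = some m.rule := render_ruleAt_nil
    have hr' : (render out c m').ruleAt [] = some m.rule := by rw [render_ruleAt_nil, h.rule_eq]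
    generalize e : m.rule = r at *
    by_cases hm : r.IsModal
    · have full : (∀ d x x', layer (Good out M) (Frag out M (Good out M) s i) s (r.next none b)
          d x x' → Good out M d x x') → render out c m (b :: w) = render out c m' (b :: w) := by
        intro hg
        rw [render_cons, render_cons]
        generalize m.child out c b = p at hc
        generalize m'.child out c b = p' at hc
        cases hc with
        | none => rfl
        | same hr _ => exact absurd hm hr
        | modal _ h => exact congrFun (hg _ _ _ h).derives.render_eq w
      cases r with
      | box A =>
        rw [SeqTree.trunc_cons_of_box hr, SeqTree.trunc_cons_of_box hr']
        exact full fun d x x' h => layer_none_left.1 h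
      | boxPlus A =>
        by_cases hs : b = true ∧ s = some A
        · obtain ⟨rfl, rfl⟩ := hs
          cases i with
          | zero => rw [SeqTree.trunc_one_cons hr, SeqTree.trunc_one_cons hr']
          | succ i =>
            rw [SeqTree.trunc_add_two_cons hr, SeqTree.trunc_add_two_cons hr']
            generalize hp : m.child out c true = p at hc
            generalize hp' : m'.child out c true = p' at hc
            cases hc with
            | none => rw [render_sub_none hp, render_sub_none hp']
            | same hr _ => exact absurd hm hr
            | @modal d x x' _ h =>
              rw [render_sub hp, render_sub hp']
              have h' : Frag out M (Good out M) (some A) (i + 1) d x x' := by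
                simpa [layer, Rule.next] using h
              exact ih h'
        · rw [SeqTree.trunc_cons_of_boxPlus hr hs, SeqTree.trunc_cons_of_boxPlus hr' hs]
          refine full fun d x x' h => ?_
          rw [layer, if_neg] at h
          · exact h
          · rintro ⟨h₁, h₂⟩
            cases b
            · exact h₁ rfl
            · exact hs ⟨rfl, h₂.symm⟩
      | _ => exact hm.elim
    · have hm₁ : ∀ r', (render out c m).ruleAt [] = some r' → ¬ r'.IsModal := by
        rw [hr]; rintro _ ⟨⟩; exact hm
      have hm₂ : ∀ r', (render out c m').ruleAt [] = some r' → ¬ r'.IsModal := by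
        rw [hr']; rintro _ ⟨⟩; exact hm
      rw [SeqTree.trunc_cons_of_not_modal hm₁, SeqTree.trunc_cons_of_not_modal hm₂]
      generalize hp : m.child out c b = p at hc
      generalize hp' : m'.child out c b = p' at hc
      cases hc with
      | none => rw [render_sub_none hp, render_sub_none hp']
      | same hr h => rw [render_sub hp, render_sub hp']; exact ih h
      | modal hr _ => exact absurd hr hm

theorem ModalOK.modalStep {S : Set Formula} {Γ : Multiset Formula} {S₀ : Finset Formula}
    {L P : Multiset Formula} (h : ModalOK M S Γ S₀ L P) : ModalStep S Γ (premAnt S₀ L P) L P := by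
  refine ⟨Γ - boxedAnt L P, S₀, h.sub, ?_, rfl⟩
  rw [add_assoc]
  exact (tsub_add_cancel_of_le h.le).symm

theorem Derives.allowed_nil (h : Derives M ρ c.ctx c.ant c.suc m m') :
    (render out c m).Allowed M [] := by
  refine ⟨fun hM A => ?_, fun hM d r p hd hr hp => ?_⟩
  · rw [render_ruleAt_nil]
    cases h with
    | cut hN => exact absurd hM hN
    | _ => simp [rule]
  · rw [render_nil] at hd
    cases hd
    rw [List.nil_append, render_seqAt_singleton] at hp
    cases h with
    | @box _ _ _ S₀ L P _ _ hm hA hx =>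
      cases hp
      exact ⟨L, P, (hm.slim hM).1, (hm.slim hM).2, hm.modalStep⟩
    | @boxPlus _ _ _ S₀ L P _ _ _ _ hm hA hx hy =>
      cases hp
      exact ⟨L, P, (hm.slim hM).1, (hm.slim hM).2, hm.modalStep⟩
    | _ => exact hr.elim

theorem Derives.allowed (h : Derives M (fun _ => Good out M) c.ctx c.ant c.suc m m')
    (w : List Bool) : (render out c m).Allowed M w := by
  induction w generalizing c m m' with
  | nil => exact h.allowed_nil
  | cons b w ih =>
    have hc := h.child (out := out) b
    change ((render out c m).sub b).Allowed M w
    generalize hp : m.child out c b = p at hc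
    generalize m'.child out c b = p' at hc
    cases hc with
    | none => rw [render_sub_none hp]; exact SeqTree.allowed_of_eq_none rfl
    | same hr h => rw [render_sub hp]; exact ih h
    | modal hr h => rw [render_sub hp]; exact ih h.derives

theorem Derives.allowed_of_trunc
    (h : Derives M (layer (Good out M) (Frag out M (Good out M) s i) s) c.ctx c.ant c.suc m m')
    {w : List Bool} (hw : ((render out c m).trunc s (i + 1) w).isSome) :
    (render out c m).Allowed M w := by
  induction w generalizing c m m' i with
  | nil => exact h.allowed_nil
  | cons b w ih =>
    have hc := h.child (out := out) b
    have hr : (render out c m).ruleAt [] = some m.rule := render_ruleAt_nil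
    change ((render out c m).sub b).Allowed M w
    generalize hp : m.child out c b = p at hc
    generalize m'.child out c b = p' at hc
    generalize m.rule = r at *
    cases hc with
    | none => rw [render_sub_none hp]; exact SeqTree.allowed_of_eq_none rfl
    | same hm h =>
      have hm₁ : ∀ r', (render out c m).ruleAt [] = some r' → ¬ r'.IsModal := by
        rw [hr]; rintro _ ⟨⟩; exact hm
      rw [SeqTree.trunc_cons_of_not_modal hm₁, render_sub hp] at hw
      rw [render_sub hp]
      exact ih h hw
    | @modal d x x' hm h =>
      rw [render_sub hp]
      unfold layer at h
      split_ifs at h with hs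
      · obtain ⟨h₁, h₂⟩ := hs
        cases r with
        | boxPlus A =>
          cases b with
          | false => exact absurd rfl h₁
          | true =>
            obtain rfl : some A = s := h₂
            cases i with
            | zero => rw [SeqTree.trunc_one_cons hr] at hw; cases hw
            | succ i =>
              rw [SeqTree.trunc_add_two_cons hr, render_sub hp] at hw
              exact ih h hw
        | box A => exact absurd rfl h₁
        | _ => exact hm.elim
      · exact h.derives.allowed w

theorem Derives.inference (h : Derives M ρ c.ctx c.ant c.suc m m') :
    ∃ ps : List Sequent, Inference c m.rule ps ∧
      ∀ b : Bool, (m.child out c b).map Prod.fst = ps[b.toNat]? := by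
  obtain ⟨S, Γ, Δ⟩ := c
  cases h with
  | ax h =>
    refine ⟨[], ?_, by rintro (_ | _) <;> rfl⟩
    rcases h with h | ⟨p, h₁, h₂⟩
    · obtain ⟨Γ, rfl⟩ := Multiset.exists_cons_of_mem h
      exact .axBot S Γ Δ
    · obtain ⟨Γ, rfl⟩ := Multiset.exists_cons_of_mem h₁
      obtain ⟨Δ, rfl⟩ := Multiset.exists_cons_of_mem h₂
      exact .axVar S Γ Δ p
  | impL e hl hr =>
    dsimp only at e
    subst e
    exact ⟨_, .impL S _ Δ _ _, by rintro (_ | _) <;> simp [MainTree.child]⟩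
  | impR e hl =>
    dsimp only at e
    subst e
    exact ⟨_, .impR S Γ _ _ _, by rintro (_ | _) <;> simp [MainTree.child]⟩
  | cut hM hl hr => exact ⟨_, .cut S Γ Δ _, by rintro (_ | _) <;> rfl⟩
  | box hm hA hx =>
    obtain ⟨Δ, rfl⟩ := Multiset.exists_cons_of_mem hA
    exact ⟨_, .box S Γ _ _ _ Δ _ hm.modalStep, by rintro (_ | _) <;> rfl⟩
  | boxPlus hm hA hx hy =>
    obtain ⟨Δ, rfl⟩ := Multiset.exists_cons_of_mem hA
    exact ⟨_, .boxPlus S Γ _ _ _ Δ _ hm.modalStep, by rintro (_ | _) <;> rfl⟩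

/-! ### Infinite branches of rendered trees -/

/-- The path is an infinite branch. -/
def SeqTree.IsBranch (t : SeqTree) (f : ℕ → Bool) : Prop := ∀ n, (t (pathPrefix f n)).isSome

/-- The infinite branch satisfies the condition on infinite branches in `∞`-proofs. -/
def SeqTree.HasGoodTail (t : SeqTree) (f : ℕ → Bool) : Prop := ∃ N A, GoodTail t f N A

theorem SeqTree.HasGoodTail.of_sub {t : SeqTree} {f : ℕ → Bool}
    (h : (t.sub (f 0)).HasGoodTail fun k => f (k + 1)) : t.HasGoodTail f := by
  obtain ⟨N, A, h⟩ := h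
  exact ⟨N + 1, A, goodTail_succ_iff.2 h⟩

theorem SeqTree.IsBranch.sub {t : SeqTree} {f : ℕ → Bool} (h : t.IsBranch f) :
    (t.sub (f 0)).IsBranch fun k => f (k + 1) := by
  intro n
  have := h (n + 1)
  rw [pathPrefix_succ'] at this
  exact this

theorem SeqTree.IsBranch.exists_child {f : ℕ → Bool} (h : (render out c m).IsBranch f) :
    ∃ p, m.child out c (f 0) = some p := by
  have := h 1
  rw [pathPrefix_succ', pathPrefix_zero, render_cons] at this
  cases e : m.child out c (f 0) with
  | none => rw [e] at this; cases this
  | some p => exact ⟨p, rfl⟩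

/-- This measure bounds the number of non-modal steps before the next modal inference. -/
theorem sizeOf_child_lt_of_not_modal {p : Sequent × MainTree CutTerm} (h : ¬ m.rule.IsModal)
    (hp : m.child out c b = some p) : sizeOf p.2 < sizeOf m := by
  cases m <;> cases b <;>
    first
      | exact absurd trivial h
      | (simp only [MainTree.child, reduceCtorEq] at hp; done)
      | (simp only [MainTree.child, Option.some.injEq] at hp
         subst hp
         simp only [impL.sizeOf_spec, impR.sizeOf_spec, cut.sizeOf_spec]
         omega)

/-- The state of a walk along a branch without a good tail. -/
structure BadBranch (out : SeqTree → MainTree CutTerm) (M : Mode) (X Y : TermRel) (s : Annot)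
    (t : SeqTree) (f : ℕ → Bool) : Prop where
  exists_derives : ∃ c m m', t = render out c m ∧ Derives M (layer X Y s) c.ctx c.ant c.suc m m'
  isBranch : t.IsBranch f
  bad : ¬ t.HasGoodTail f

variable {X Y : TermRel} {f : ℕ → Bool} {u : SeqTree}

/-- By `hX` a branch that enters an X-premise has a good tail. A bad branch therefore meets modal
inferences only by taking right premises of □⁺ that retain s. -/
theorem BadBranch.step
    (hX : ∀ d x x' g, X d x x' → (render out d (x.head out)).IsBranch g →
      (render out d (x.head out)).HasGoodTail g)
    (hY : ∀ d x x', Y d x x' → Derives M (layer X Y s) d.ctx d.ant d.suc (x.head out) (x'.head out))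
    (h : BadBranch out M X Y s u f) :
    BadBranch out M X Y s (u.sub (f 0)) (fun k => f (k + 1)) ∧ ∃ r, u.ruleAt [] = some r ∧
      (r.IsModal → f 0 = true ∧ ∃ A, s = some A ∧ r = .boxPlus A) := by
  obtain ⟨⟨c, m, m', rfl, hd⟩, hf, hbad⟩ := h
  have hc := hd.child (out := out) (f 0)
  have hsub := hf.sub
  have hbad' := fun h => hbad (SeqTree.HasGoodTail.of_sub h)
  obtain ⟨p₀, hp₀⟩ := hf.exists_child
  generalize hp : m.child out c (f 0) = p at hc
  generalize m'.child out c (f 0) = p' at hc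
  rw [render_ruleAt_nil]
  cases hc with
  | none => rw [hp] at hp₀; cases hp₀
  | same hr h =>
    exact ⟨⟨⟨_, _, _, render_sub hp, h⟩, hsub, hbad'⟩, m.rule, rfl, fun h => absurd h hr⟩
  | modal hr h =>
    unfold layer at h
    split_ifs at h with hs
    · refine ⟨⟨⟨_, _, _, render_sub hp, hY _ _ _ h⟩, hsub, hbad'⟩, m.rule, rfl, fun _ => ?_⟩
      obtain ⟨h₁, h₂⟩ := hs
      generalize m.rule = r at *
      generalize f 0 = b at *
      cases r with
      | boxPlus A =>
        cases b with
        | false => exact absurd rfl h₁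
        | true => exact ⟨rfl, A, h₂.symm, rfl⟩
      | box A => exact absurd rfl h₁
      | _ => exact hr.elim
    · rw [render_sub hp] at hsub hbad'
      exact absurd (hX _ _ _ _ h hsub) hbad'

theorem BadBranch.iterate
    (hX : ∀ d x x' g, X d x x' → (render out d (x.head out)).IsBranch g →
      (render out d (x.head out)).HasGoodTail g)
    (hY : ∀ d x x', Y d x x' → Derives M (layer X Y s) d.ctx d.ant d.suc (x.head out) (x'.head out))
    (h : BadBranch out M X Y s u f) (n : ℕ) :
    BadBranch out M X Y s (fun w => u (pathPrefix f n ++ w)) (fun k => f (n + k)) := by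
  induction n with
  | zero => simpa [pathPrefix_zero] using h
  | succ n ih =>
    have := (ih.step hX hY).1
    have e : (fun w => u (pathPrefix f (n + 1) ++ w)) =
        SeqTree.sub (fun w => u (pathPrefix f n ++ w)) (f (n + 0)) := by
      funext w
      rw [pathPrefix_succ]
      simp [SeqTree.sub]
    rw [e]
    convert this using 3
    omega

theorem BadBranch.exists_modal
    (hX : ∀ d x x' g, X d x x' → (render out d (x.head out)).IsBranch g →
      (render out d (x.head out)).HasGoodTail g)
    (hY : ∀ d x x', Y d x x' → Derives M (layer X Y s) d.ctx d.ant d.suc (x.head out) (x'.head out))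
    (h : BadBranch out M X Y s u f) :
    ∃ n A, f n = true ∧ s = some A ∧ u.ruleAt (pathPrefix f n) = some (.boxPlus A) := by
  obtain ⟨⟨c, m, m', rfl, hd⟩, hf, hbad⟩ := id h
  induction hn : sizeOf m using Nat.strong_induction_on generalizing c m m' f with
  | _ n ih =>
    obtain ⟨h₁, r, hr, h₂⟩ := h.step hX hY
    by_cases hm : r.IsModal
    · obtain ⟨h₃, A, h₄, rfl⟩ := h₂ hm
      exact ⟨0, A, h₃, h₄, hr⟩
    · have hc := hd.child (out := out) (f 0)
      obtain ⟨p₀, hp₀⟩ := hf.exists_child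
      have hm' : ¬ m.rule.IsModal := by
        rw [render_ruleAt_nil] at hr; cases hr; exact hm
      generalize hp : m.child out c (f 0) = p at hc
      generalize m'.child out c (f 0) = p' at hc
      cases hc with
      | none => rw [hp] at hp₀; cases hp₀
      | modal hr _ => exact absurd hr hm'
      | same _ hd' =>
        rw [render_sub hp] at h₁
        obtain ⟨k, A, h₃, h₄, h₅⟩ := ih _ (hn ▸ sizeOf_child_lt_of_not_modal hm' hp) _ _ _ hd'
          h₁ h₁.isBranch h₁.bad rfl
        refine ⟨k + 1, A, h₃, h₄, ?_⟩
        rw [← h₅, pathPrefix_succ', ← render_sub hp]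
        rfl

/-- Main trees are finite, so modal inferences recur infinitely often, and each is □⁺ with the
formula of s, passed on the right. The whole branch is then a good tail. -/
theorem BadBranch.false
    (hX : ∀ d x x' g, X d x x' → (render out d (x.head out)).IsBranch g →
      (render out d (x.head out)).HasGoodTail g)
    (hY : ∀ d x x', Y d x x' → Derives M (layer X Y s) d.ctx d.ant d.suc (x.head out) (x'.head out))
    (h : BadBranch out M X Y s u f) : False := by
  obtain ⟨-, A, -, rfl, -⟩ := h.exists_modal hX hY
  have key : ∀ n, ∃ r, u.ruleAt (pathPrefix f n) = some r ∧
      (r.IsModal → f n = true ∧ r = .boxPlus A) := by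
    intro n
    obtain ⟨-, r, hr, h₁⟩ := (h.iterate hX hY n).step hX hY
    refine ⟨r, by simpa [SeqTree.ruleAt] using hr, fun hm => ?_⟩
    obtain ⟨h₂, B, h₃, h₄⟩ := h₁ hm
    cases h₃
    exact ⟨h₂, h₄⟩
  refine h.bad ⟨0, A, fun n _ B hB => ?_, fun n => ?_, fun n _ B hB => ?_, fun n _ B hB => ?_⟩
  · obtain ⟨r, hr, h₁⟩ := key n
    cases hr.symm.trans hB
    cases (h₁ trivial).2
    rfl
  · obtain ⟨k, B, h₁, -, h₂⟩ := (h.iterate hX hY n).exists_modal hX hY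
    refine ⟨n + k, Nat.le_add_right _ _, B, ?_, h₁⟩
    have : pathPrefix f (n + k) = pathPrefix f n ++ pathPrefix (fun k => f (n + k)) k := by
      simp [pathPrefix, List.range_add, Function.comp_def]
    rw [this]
    exact h₂
  · obtain ⟨r, hr, h₁⟩ := key n
    cases hr.symm.trans hB
    simp [(h₁ trivial).1]
  · obtain ⟨r, hr, h₁⟩ := key n
    cases hr.symm.trans hB
    cases (h₁ trivial).2

theorem Good.hasGoodTail (h : Good out M c t t') :
    ∀ f, (render out c (t.head out)).IsBranch f → (render out c (t.head out)).HasGoodTail f := by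
  refine Good.induction (X := fun c t _ => ∀ f, (render out c (t.head out)).IsBranch f →
    (render out c (t.head out)).HasGoodTail f) ?_ h
  clear h
  intro c t t' s h f hf
  by_contra hbad
  set X : TermRel := fun c t t' => Good out M c t t' ∧ ∀ f,
    (render out c (t.head out)).IsBranch f → (render out c (t.head out)).HasGoodTail f
  -- The conjunction of all approximations is a fixed point of the inner layer, so it can be
  -- maintained along an infinite path.
  have hY : ∀ d x x', (∀ i, Frag out M X s i d x x') →
      Derives M (layer X (fun d x x' => ∀ i, Frag out M X s i d x x') s) d.ctx d.ant d.suc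
        (x.head out) (x'.head out) := by
    intro d x x' hx
    refine (Derives.forall_nat fun i => hx (i + 1)).mono fun a d y y' hy => ?_
    unfold layer at *
    split_ifs at * with ha
    · exact hy
    · exact hy 0
  exact BadBranch.false (fun d x x' g hx hg => hx.2 g hg) hY ⟨⟨c, _, _, rfl, hY _ _ _ h⟩, hf, hbad⟩

theorem Good.isProof (h : Good out M c t t') : (render out c (t.head out)).IsProof where
  root_mem := by rw [render_nil]; rfl
  closed w b := by
    generalize t.head out = m
    clear h
    induction w generalizing c m with
    | nil => rw [render_nil]; intro h; cases h
    | cons b' w ih =>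
      rw [List.cons_append, render_cons, render_cons]
      cases m.child out c b' with
      | none => exact id
      | some p => exact ih p.2
  step w c' r hw := by
    have hd := h.derives
    generalize t.head out = m at *
    generalize t'.head out = m' at *
    clear h
    induction w generalizing c m m' with
    | nil =>
      rw [render_nil] at hw
      cases hw
      simp only [List.nil_append, render_seqAt_singleton]
      exact hd.inference
    | cons b w ih =>
      have hc := hd.child (out := out) b
      generalize hp : m.child out c b = p at hc
      generalize m'.child out c b = p' at hc
      change ((render out c m).sub b) w = _ at hw
      change ∃ ps, _ ∧ ∀ b', ((render out c m).sub b).seqAt (w ++ [b']) = _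
      cases hc with
      | none => rw [render_sub_none hp] at hw; cases hw
      | same hr h =>
        rw [render_sub hp] at hw ⊢
        exact ih _ hw _ h
      | modal hr h =>
        rw [render_sub hp] at hw ⊢
        exact ih _ hw _ h.derives
  branch f hf := h.hasGoodTail f hf

end Render

/-! ### The operation on ∞-proofs -/

section Operation

open SeqTree MainTree

variable {A : Formula} {c : Sequent} {π τ π' τ' : InfProof} {M : Mode} {s : Annot} {i : ℕ}

theorem InfProof.seqAt_nil (π : InfProof) : π.tree.seqAt [] = some π.root := by
  change Option.map Prod.fst (π.tree []) = some ((π.tree []).get π.root_mem).1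
  rw [← Option.map_some, Option.some_get]

theorem InfProof.root_eq (h : π.tree.seqAt [] = some c) : π.root = c := by
  rw [π.seqAt_nil] at h
  exact Option.some.inj h

/-- The tree obtained by the elimination of a cut. -/
noncomputable def cutResult (A : Formula) (c : Sequent) (π τ : InfProof) : SeqTree :=
  render mainTree c (CutTerm.head mainTree (.elim A c.suc (.leaf π.tree) (.leaf τ.tree)))

open Classical in
/-- The operation that removes cuts with the cut formula `A`. -/
noncomputable def removeCut (A : Formula) (π τ : InfProof) : InfProof :=
  if h : ∃ c, IsCutPair A c π τ ∧ (cutResult A c π τ).IsProof then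
    { tree := cutResult A h.choose π τ
      root_mem := h.choose_spec.2.root_mem
      closed := h.choose_spec.2.closed
      step := h.choose_spec.2.step
      branch := h.choose_spec.2.branch }
  -- Outside cut pairs the first projection has all the required properties.
  else π

theorem IsCutPair.unique {c' : Sequent} (h : IsCutPair A c π τ) (h' : IsCutPair A c' π τ) :
    c = c' := by
  have h₁ := h.1.symm.trans h'.1
  have h₂ := h.2.symm.trans h'.2
  simp only [Sequent.mk.injEq] at h₁ h₂
  exact Sequent.ext h₁.1 h₁.2.1 h₂.2.2

theorem IsCutPair.isProof (h : IsCutPair A c π τ) : (cutResult A c π τ).IsProof := by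
  have hgood : ∀ π : InfProof, Good mainTree ⟨False, False⟩ π.root (.leaf π.tree) (.leaf π.tree) :=
    fun π => (IsProof.of_infProof π).good (fun w => ⟨False.elim, False.elim⟩) π.seqAt_nil
  have hπ := hgood π
  have hτ := hgood τ
  rw [h.1] at hπ
  rw [h.2] at hτ
  exact ((cutEliminable A).good hπ hτ).isProof

theorem IsCutPair.removeCut_tree (h : IsCutPair A c π τ) :
    (removeCut A π τ).tree = cutResult A c π τ := by
  have h' : ∃ c, IsCutPair A c π τ ∧ (cutResult A c π τ).IsProof := ⟨c, h, h.isProof⟩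
  rw [removeCut, dif_pos h', h.unique h'.choose_spec.1]

theorem removeCut_of_not (h : ¬ ∃ c, IsCutPair A c π τ) : removeCut A π τ = π :=
  dif_neg fun ⟨c, hc, _⟩ => h ⟨c, hc⟩

theorem IsCutPair.removeCut_root (h : IsCutPair A c π τ) : (removeCut A π τ).root = c :=
  InfProof.root_eq (by rw [h.removeCut_tree]; exact render_seqAt_nil)

theorem isRemoving_removeCut (A : Formula) : IsRemoving A (removeCut A) := by
  refine ⟨fun π τ s hs => ?_, fun c π τ h => h.removeCut_root⟩
  by_cases h : ∃ c, IsCutPair A c π τ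
  · obtain ⟨c, h⟩ := h
    have hs' := hs.2
    rw [InfProof.Ann, h.2] at hs'
    rw [InfProof.Ann, h.removeCut_root]
    exact hs'
  · rw [removeCut_of_not h]
    exact hs.1

/-- With different pairs and no restrictions this gives non-expansiveness; with a pair compared to
itself and a restrictive mode it gives the other two properties. -/
theorem IsCutPair.removeCut_frag (h : IsCutPair A c π τ) (h' : IsCutPair A c π' τ')
    (hs : s ∈ τ.Ann)
    (hπ : π.tree.trunc s (i + 1) = π'.tree.trunc s (i + 1))
    (hτ : τ.tree.trunc s (i + 1) = τ'.tree.trunc s (i + 1))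
    (hMπ : ∀ w, (π.tree.trunc s (i + 1) w).isSome → π.tree.Allowed M w)
    (hMτ : ∀ w, (τ.tree.trunc s (i + 1) w).isSome → τ.tree.Allowed M w) :
    (removeCut A π τ).tree.trunc s (i + 1) = (removeCut A π' τ').tree.trunc s (i + 1) ∧
      ∀ w, ((removeCut A π τ).tree.trunc s (i + 1) w).isSome →
        (removeCut A π τ).tree.Allowed M w := by
  have h₁ := (IsProof.of_infProof π).frag_leaf (IsProof.of_infProof π') π.seqAt_nil hπ hMπ
  have h₂ := (IsProof.of_infProof τ).frag_leaf (IsProof.of_infProof τ') τ.seqAt_nil hτ hMτ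
  rw [h.1] at h₁
  rw [h.2] at h₂
  -- The right premise of the cut has the same right-hand side as the conclusion, so s is a possible
  -- annotation of the conclusion.
  rw [InfProof.Ann, h.2] at hs
  have h₃ := (cutEliminable A).frag (Γ := c.ant) hs h₁ h₂
  rw [h.removeCut_tree, h'.removeCut_tree]
  exact ⟨Derives.trunc_render_eq h₃, fun w hw => Derives.allowed_of_trunc h₃ hw⟩

theorem removeCut_allowed (hs : s ∈ τ.Ann)
    (hMπ : ∀ w, InFragment π.tree s (i + 1) w → π.tree.Allowed M w)
    (hMτ : ∀ w, InFragment τ.tree s (i + 1) w → τ.tree.Allowed M w) {w : List Bool}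
    (hw : InFragment (removeCut A π τ).tree s (i + 1) w) : (removeCut A π τ).tree.Allowed M w := by
  simp only [← isSome_trunc (Nat.succ_pos i)] at hMπ hMτ hw
  by_cases h : ∃ c, IsCutPair A c π τ
  · obtain ⟨c, h⟩ := h
    exact (h.removeCut_frag h hs rfl rfl hMπ hMτ).2 w hw
  · rw [removeCut_of_not h] at hw ⊢
    exact hMπ w hw

theorem nonExpansive_removeCut (A : Formula) : NonExpansive (removeCut A) := by
  intro s i π τ π' τ' hπ hτ
  refine ⟨(isRemoving_removeCut A).1 π τ ⟨hπ.1, hτ.1⟩,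
    (isRemoving_removeCut A).1 π' τ' ⟨hπ.2.1, hτ.2.1⟩, fun hi => ?_⟩
  have h₁ := (fragment_eq_iff hi).1 (hπ.2.2 hi)
  have h₂ := (fragment_eq_iff hi).1 (hτ.2.2 hi)
  rw [fragment_eq_iff hi]
  -- The root belongs to every i-fragment with i > 0, so both pairs are cut pairs with the same
  -- result or neither is a cut pair.
  have hroot : ∀ {σ σ' : InfProof}, σ.tree.trunc s i = σ'.tree.trunc s i → σ'.root = σ.root :=
    fun {σ σ'} h => InfProof.root_eq
      ((congrArg (Option.map Prod.fst) (congrFun h [])).symm.trans σ.seqAt_nil)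
  have hpair : ∀ c, IsCutPair A c π τ ↔ IsCutPair A c π' τ' := fun c => by
    rw [IsCutPair, IsCutPair, hroot h₁, hroot h₂]
  obtain ⟨i, rfl⟩ : ∃ k, i = k + 1 := ⟨i - 1, by omega⟩
  by_cases h : ∃ c, IsCutPair A c π τ
  · obtain ⟨c, h⟩ := h
    exact (h.removeCut_frag (M := ⟨False, False⟩) ((hpair c).1 h) hτ.1 h₁ h₂
      (fun w _ => ⟨False.elim, False.elim⟩) (fun w _ => ⟨False.elim, False.elim⟩)).1
  · rw [removeCut_of_not h, removeCut_of_not (by simpa only [hpair] using h), h₁]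

theorem nonPollutive_removeCut (A : Formula) : NonPollutive (removeCut A) := by
  intro s i π τ hπ hτ
  refine ⟨(isRemoving_removeCut A).1 π τ ⟨hπ.1, hτ.1⟩, fun hi w hw => ?_⟩
  obtain ⟨i, rfl⟩ : ∃ k, i = k + 1 := ⟨i - 1, by omega⟩
  exact (removeCut_allowed (M := ⟨True, False⟩) hτ.1
    (fun w hw => ⟨fun _ => hπ.2 hi w hw, False.elim⟩)
    (fun w hw => ⟨fun _ => hτ.2 hi w hw, False.elim⟩) hw).1 trivial

theorem nonFattening_removeCut (A : Formula) : NonFattening (removeCut A) := by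
  intro s i π τ hπ hτ
  refine ⟨(isRemoving_removeCut A).1 π τ ⟨hπ.1, hτ.1⟩, fun hi w hw => ?_⟩
  obtain ⟨i, rfl⟩ : ∃ k, i = k + 1 := ⟨i - 1, by omega⟩
  exact (removeCut_allowed (M := ⟨False, True⟩) hτ.1
    (fun w hw => ⟨False.elim, fun _ => hπ.2 hi w hw⟩)
    (fun w hw => ⟨False.elim, fun _ => hτ.2 hi w hw⟩) hw).2 trivial

end Operation

theorem mainTheorem2 (A : Formula) :
    ∃ re : InfProof → InfProof → InfProof,
      IsRemoving A re ∧ NonExpansive re ∧ NonPollutive re ∧ NonFattening re := by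
  exact ⟨removeCut A, isRemoving_removeCut A, nonExpansive_removeCut A, nonPollutive_removeCut A,
    nonFattening_removeCut A⟩
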